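/- Let $\mathbb{T}=\mathbb{R}/\mathbb{Z}$ with Lebesgue measure $d\theta$, and let $c:\{0,1\}^{\mathbb{Z}}\to\mathbb{R}$ be strictly positive and depend on finitely many coordinates only. With $\nu_r$ the Bernoulli product measure on $\{0,1\}^{\mathbb{Z}}$ of density $r\in[0,1]$, put $$B(r)=\int[1-\eta(0)]\,c(\eta)\,d\nu_r,\qquad D(r)=\int\eta(0)\,c(\eta)\,d\nu_r,\qquad F=B-D,\qquad \chi(r)=r(1-r).$$ A density profile is a measurable function $\gamma:\mathbb{T}\to[0,1]$. Let $\mathcal{M}_+$ be the set of nonnegative measures on $\mathbb{T}$ of total mass at most $1$ with the weak topology, $\mathcal{M}_{+,1}\subset\mathcal{M}_+$ the set of measures $\gamma(\theta)d\theta$ with $\gamma$ a density profile, and $D([0,T],\mathcal{M}_+)$ the set of right-continuous paths with left limits. Write $\langle\cdot,\cdot\rangle$ for integration over $\mathbb{T}$, and $\nabla$, $\Delta$ for the first and second derivatives in $\theta$. *Rate function.* Let $T>0$. For $\pi\in D([0,T],\mathcal{M}_+)$ with $\pi_t=\rho_t(\theta)d\theta\in\mathcal{M}_{+,1}$ for all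 $t\in[0,T]$, let $$\mathcal{Q}_T(\pi)=\sup_{G\in C^{0,1}([0,T]\times\mathbb{T})}\Big\{2\int_0^T\langle\rho_t,\nabla G_t\rangle\,dt-\int_0^T\!\!\int_{\mathbb{T}}G(t,\theta)^2\,d\theta\,dt\Big\},$$ and, for $G\in C^{1,2}([0,T]\times\mathbb{T})$, $$\bar J_{T,G}(\pi)=\langle\pi_T,G_T\rangle-\langle\pi_0,G_0\rangle-\int_0^T\big\langle\pi_t,\partial_tG_t+\tfrac12\Delta G_t\big\rangle dt-\frac12\int_0^T\langle\chi(\rho_t),(\nabla G_t)^2\rangle\,dt-\int_0^T\big\{\langle B(\rho_t),e^{G_t}-1\rangle+\langle D(\rho_t),e^{-G_t}-1\rangle\big\}dt .$$ Set $I_T(\pi)=\sup_{G\in C^{1,2}([0,T]\times\mathbb{T})}\bar J_{T,G}(\pi)$ if $\pi$ takes values in $\mathcal{M}_{+,1}$ and $\mathcal{Q}_T(\pi)<\infty$, and $I_T(\pi)=\infty$ otherwise. For a density profile $\gamma$, set $I_T(\pi|\gamma)=I_T(\pi)$ if $\pi_0=\gamma(\theta)d\theta$, and $I_T(\pi|\gamma)=\infty$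 otherwise. *Stationary solutions.* Let $S$ be the set of $C^2$ functions $\rho:\mathbb{T}\to[0,1]$ with $\frac12\Delta\rho+F(\rho)=0$ on $\mathbb{T}$, and $\mathcal{M}_{\rm sol}=\{\rho(\theta)d\theta:\rho\in S\}$. Assume that there are finitely many stationary solutions modulo translations: there are $C^2$ density profiles $\bar\rho_1,\dots,\bar\rho_l$ such that $\mathcal{M}_{\rm sol}=\bigcup_{i=1}^l\mathcal{M}_i$, where $\mathcal{M}_i=\{\bar\rho_i(\theta-\omega)d\theta:\omega\in\mathbb{T}\}$. For $\varrho\in\mathcal{M}_+$ let $$V_i(\varrho)=\inf\big\{I_T(\pi|\gamma):\ T>0,\ \gamma(\theta)d\theta\in\mathcal{M}_i,\ \pi\in D([0,T],\mathcal{M}_+),\ \pi_T=\varrho\big\},\qquad v_{ij}=V_i\big(\bar\rho_j(\theta)d\theta\big).$$ *Heteroclinic orbits.* A measurable $\rho:[0,T]\times\mathbb{T}\to[0,1]$ is a weak solution on $[0,T]$ of $\partial_t\rho=\frac12\Delta\rho+F(\rho)$ with initial condition $\gamma$ if for all $G\in C^{1,2}([0,T]\times\mathbb{T})$ $$\langle\rho_T,G_T\rangle-\langle\gamma,G_0\rangle-\int_0^T\langle\rho_t,\partial_tG_t\rangle\,dt=\frac12\int_0^T\langle\rho_t,\Delta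 G_t\rangle\,dt+\int_0^T\langle F(\rho_t),G_t\rangle\,dt .$$ For $\phi\neq\psi$ in $S$, a heteroclinic orbit from $\phi$ to $\psi$ is a family $(\rho_t)_{t\in\mathbb{R}}$ of density profiles such that for all $s\in\mathbb{R}$ and $T>0$ the function $(t,\theta)\mapsto\rho_{s+t}(\theta)$ is a weak solution on $[0,T]$ with initial condition $\rho_s$, and such that $\rho_t\to\phi$ as $t\to-\infty$ and $\rho_t\to\psi$ as $t\to+\infty$ in $C^1(\mathbb{T})$. **Lemma.** Let $i,j\in\{1,\dots,l\}$, and suppose that there is a heteroclinic orbit from some $\phi$ with $\phi(\theta)d\theta\in\mathcal{M}_i$ to some $\psi$ with $\psi(\theta)d\theta\in\mathcal{M}_j$. Then $V_i$ is constant on $\mathcal{M}_j$, equal to $v_{ij}$, and $v_{ij}=0$. -/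

import Mathlib

open MeasureTheory Filter Topology Set

namespace ReactionDiffusion

/-! ### The torus, configurations and the reaction terms -/

/-- The one-dimensional torus `ℝ / ℤ`; `volume` is Lebesgue measure, of total mass one. -/
abbrev Torus : Type := UnitAddCircle

/-- Configurations `{0,1}^ℤ`; `true` means occupied. -/
abbrev Config : Type := ℤ → Bool

/-- The occupation variable of a site, as a real number. -/
def occ (b : Bool) : ℝ := if b then 1 else 0

/-- A cylinder function: it depends on finitely many coordinates only. -/
def IsCylinder (c : Config → ℝ) : Prop := ∃ s : Finset ℤ, DependsOn c (s : Set ℤ)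

/-- The Bernoulli product measure with density `r`. The functions below are used for `r ∈ [0,1]`
only; `projIcc` extends them (constantly) to all of `ℝ`. -/
noncomputable def bernoulliProduct (r : ℝ) : Measure Config :=
  Measure.infinitePi fun _ : ℤ =>
    ProbabilityTheory.bernoulliMeasure true false (projIcc (0 : ℝ) 1 zero_le_one r)

/-- `B(r) = ∫ (1 - η(0)) c(η) dν_r`. -/
noncomputable def birth (c : Config → ℝ) (r : ℝ) : ℝ :=
  ∫ η, (1 - occ (η 0)) * c η ∂(bernoulliProduct r)

/-- `D(r) = ∫ η(0) c(η) dν_r`. -/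
noncomputable def death (c : Config → ℝ) (r : ℝ) : ℝ :=
  ∫ η, occ (η 0) * c η ∂(bernoulliProduct r)

/-- `F = B - D`. -/
noncomputable def reaction (c : Config → ℝ) (r : ℝ) : ℝ := birth c r - death c r

/-- The mobility `χ(r) = r (1 - r)`. -/
def mobility (r : ℝ) : ℝ := r * (1 - r)

/-! ### Measures and density profiles -/

/-- The space of nonnegative measures on the torus with total mass at most one, with the weak
topology (the subspace topology of Mathlib's `FiniteMeasure`). -/
abbrev SubProb : Type := {μ : FiniteMeasure Torus // μ.mass ≤ 1}

/-- The measure underlying an element of `SubProb`. -/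
noncomputable def SubProb.meas (ϱ : SubProb) : Measure Torus := (ϱ.1 : Measure Torus)

/-- A density profile: a measurable function from the torus to `[0,1]`. -/
structure Profile where
  toFun : Torus → ℝ
  measurable_toFun : Measurable toFun
  mem_Icc : ∀ θ, toFun θ ∈ Icc (0 : ℝ) 1

instance : CoeFun Profile (fun _ => Torus → ℝ) := ⟨Profile.toFun⟩

/-- The measure `γ(θ) dθ`. -/
noncomputable def Profile.meas (γ : Profile) : Measure Torus :=
  volume.withDensity fun θ => ENNReal.ofReal (γ θ)

theorem Profile.meas_univ_le (γ : Profile) : γ.meas univ ≤ 1 := by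
  rw [Profile.meas, withDensity_apply _ MeasurableSet.univ]
  calc ∫⁻ θ in univ, ENNReal.ofReal (γ θ) ≤ ∫⁻ _ in univ, (1 : ENNReal) :=
        lintegral_mono fun θ => by
          simpa using ENNReal.ofReal_le_ofReal (γ.mem_Icc θ).2
    _ = 1 := by simp

/-- The measure `γ(θ) dθ` as a finite measure. -/
noncomputable def Profile.finiteMeasure (γ : Profile) : FiniteMeasure Torus :=
  ⟨γ.meas, ⟨lt_of_le_of_lt γ.meas_univ_le ENNReal.one_lt_top⟩⟩

theorem Profile.mass_finiteMeasure_le (γ : Profile) : γ.finiteMeasure.mass ≤ 1 := by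
  rw [← ENNReal.coe_le_coe, FiniteMeasure.ennreal_mass, ENNReal.coe_one]
  exact γ.meas_univ_le

/-- The measure `γ(θ) dθ` as an element of `SubProb`. -/
noncomputable def Profile.toSubProb (γ : Profile) : SubProb :=
  ⟨γ.finiteMeasure, γ.mass_finiteMeasure_le⟩

/-- The translate `θ ↦ γ(θ - ω)`. -/
def Profile.translate (γ : Profile) (ω : Torus) : Profile where
  toFun := fun θ => γ (θ - ω)
  measurable_toFun := γ.measurable_toFun.comp (measurable_id.sub_const ω)
  mem_Icc := fun θ => γ.mem_Icc (θ - ω)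

/-- Absolutely continuous measures with a density bounded by one. -/
def SubProbOne : Set SubProb := {ϱ | ∃ γ : Profile, ϱ = γ.toSubProb}

/-- The density of (the absolutely continuous part of) a measure. -/
noncomputable def SubProb.density (ϱ : SubProb) (θ : Torus) : ℝ :=
  (ϱ.meas.rnDeriv volume θ).toReal

/-! ### Smooth functions -/

/-- A function on the torus seen as a one-periodic function on the line. -/
def lift (f : Torus → ℝ) : ℝ → ℝ := fun x => f (x : Torus)

/-- Functions of class `C^{0,1}([0,T] × 𝕋)`, together with their space derivative. -/
structure TestC01 (T : ℝ) where
  fn : ℝ → Torus → ℝ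
  dx : ℝ → Torus → ℝ
  cont_fn : ContinuousOn (fun p : ℝ × Torus => fn p.1 p.2) (Icc 0 T ×ˢ univ)
  cont_dx : ContinuousOn (fun p : ℝ × Torus => dx p.1 p.2) (Icc 0 T ×ˢ univ)
  hasDeriv_dx : ∀ t ∈ Icc (0 : ℝ) T, ∀ x : ℝ, HasDerivAt (lift (fn t)) (lift (dx t) x) x

/-- Functions of class `C^{1,2}([0,T] × 𝕋)`, together with their derivatives `∂ₜ`, `∇`, `Δ`
(the time derivative is one-sided at the endpoints). -/
structure TestC12 (T : ℝ) where
  fn : ℝ → Torus → ℝ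
  dt : ℝ → Torus → ℝ
  dx : ℝ → Torus → ℝ
  dxx : ℝ → Torus → ℝ
  cont_fn : ContinuousOn (fun p : ℝ × Torus => fn p.1 p.2) (Icc 0 T ×ˢ univ)
  cont_dt : ContinuousOn (fun p : ℝ × Torus => dt p.1 p.2) (Icc 0 T ×ˢ univ)
  cont_dx : ContinuousOn (fun p : ℝ × Torus => dx p.1 p.2) (Icc 0 T ×ˢ univ)
  cont_dxx : ContinuousOn (fun p : ℝ × Torus => dxx p.1 p.2) (Icc 0 T ×ˢ univ)
  hasDeriv_dt : ∀ t ∈ Icc (0 : ℝ) T, ∀ θ : Torus,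
    HasDerivWithinAt (fun s => fn s θ) (dt t θ) (Icc 0 T) t
  hasDeriv_dx : ∀ t ∈ Icc (0 : ℝ) T, ∀ x : ℝ, HasDerivAt (lift (fn t)) (lift (dx t) x) x
  hasDeriv_dxx : ∀ t ∈ Icc (0 : ℝ) T, ∀ x : ℝ, HasDerivAt (lift (dx t)) (lift (dxx t) x) x

/-- `f t` converges to `g` in `C¹(𝕋)` along the filter `l`. -/
def TendstoC1 (f : ℝ → Profile) (g : Profile) (l : Filter ℝ) : Prop :=
  (∀ᶠ t in l, ContDiff ℝ 1 (lift (f t))) ∧ ContDiff ℝ 1 (lift g) ∧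
  TendstoUniformly (fun t => lift (f t)) (lift g) l ∧
  TendstoUniformly (fun t => deriv (lift (f t))) (deriv (lift g)) l

/-! ### The reaction-diffusion equation -/

/-- The set of classical (`C²`, `[0,1]`-valued) solutions of `(1/2) Δρ + F(ρ) = 0` on the torus. -/
def Stationary (c : Config → ℝ) : Set Profile :=
  {γ | ContDiff ℝ 2 (lift γ) ∧
    ∀ x : ℝ, (1 / 2) * iteratedDeriv 2 (lift γ) x + reaction c (lift γ x) = 0}

/-- The set of measures whose density is a classical stationary solution. -/
def StationaryMeasures (c : Config → ℝ) : Set SubProb :=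
  {ϱ | ∃ γ ∈ Stationary c, ϱ = γ.toSubProb}

/-- Weak solution of `∂ₜρ = (1/2) Δρ + F(ρ)`, `ρ(0,·) = γ`, in the layer `[0,T] × 𝕋`. The values
of `ρ` at times outside `[0,T]` play no role. -/
def IsWeakSolution (c : Config → ℝ) (T : ℝ) (γ : Profile) (ρ : ℝ → Profile) : Prop :=
  Measurable (fun p : Icc (0 : ℝ) T × Torus => ρ p.1 p.2) ∧
  ∀ G : TestC12 T,
    (∫ θ, ρ T θ * G.fn T θ) - (∫ θ, γ θ * G.fn 0 θ) - (∫ t in 0..T, ∫ θ, ρ t θ * G.dt t θ)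
      = (1 / 2) * (∫ t in 0..T, ∫ θ, ρ t θ * G.dxx t θ)
        + ∫ t in 0..T, ∫ θ, reaction c (ρ t θ) * G.fn t θ

/-- A heteroclinic orbit from `φ` to `ψ`: two distinct stationary solutions, and a trajectory
defined for all times in `ℝ` which solves the reaction-diffusion equation (started at any time `s`,
it is on each time layer a weak solution with initial condition `ρ s`), and which converges in
`C¹(𝕋)` to `φ` at `-∞` and to `ψ` at `+∞`. -/
structure IsHeteroclinicOrbit (c : Config → ℝ) (ρ : ℝ → Profile) (φ ψ : Profile) : Prop where
  source_mem : φ ∈ Stationary c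
  target_mem : ψ ∈ Stationary c
  ne : φ ≠ ψ
  solves : ∀ s : ℝ, ∀ T : ℝ, 0 < T → IsWeakSolution c T (ρ s) (fun t => ρ (s + t))
  tendsto_source : TendstoC1 ρ φ atBot
  tendsto_target : TendstoC1 ρ ψ atTop

/-! ### The dynamical rate function

Trajectories on `[0,T]` are represented by functions on `ℝ`, of which only the restriction to
`[0,T]` is ever used. -/

/-- The restriction of `π` to `[0,T]` belongs to `D([0,T], 𝓜₊)`: it is right-continuous and has
left limits. -/
def IsCadlag (T : ℝ) (π : ℝ → SubProb) : Prop :=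
  (∀ t ∈ Ico 0 T, ContinuousWithinAt π (Icc t T) t) ∧
  (∀ t ∈ Ioc 0 T, ∃ ϱ, Tendsto π (𝓝[<] t) (𝓝 ϱ))

/-- The expression `2 ∫₀ᵀ ⟨ρₜ, ∇Gₜ⟩ dt - ∫₀ᵀ ∫ G² dθ dt`. -/
noncomputable def energyFunctional (T : ℝ) (π : ℝ → SubProb) (G : TestC01 T) : ℝ :=
  2 * (∫ t in 0..T, ∫ θ, (π t).density θ * G.dx t θ) - ∫ t in 0..T, ∫ θ, (G.fn t θ) ^ 2

/-- The energy `𝓠_T(π)`. -/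
noncomputable def energy (T : ℝ) (π : ℝ → SubProb) : EReal :=
  ⨆ G : TestC01 T, (energyFunctional T π G : EReal)

/-- The functional `J̄_{T,G}(π)`. -/
noncomputable def rateFunctional (c : Config → ℝ) (T : ℝ) (π : ℝ → SubProb) (G : TestC12 T) : ℝ :=
  (∫ θ, G.fn T θ ∂(π T).meas) - (∫ θ, G.fn 0 θ ∂(π 0).meas)
    - (∫ t in 0..T, ∫ θ, (G.dt t θ + (1 / 2) * G.dxx t θ) ∂(π t).meas)
    - (1 / 2) * (∫ t in 0..T, ∫ θ, mobility ((π t).density θ) * (G.dx t θ) ^ 2)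
    - ∫ t in 0..T,
        ((∫ θ, birth c ((π t).density θ) * (Real.exp (G.fn t θ) - 1))
          + ∫ θ, death c ((π t).density θ) * (Real.exp (-G.fn t θ) - 1))

open Classical in
/-- The rate function `I_T(π)` of a path `π ∈ D([0,T], 𝓜₊)`: the supremum of `J̄_{T,G}(π)` over
test functions `G` if `π` takes values in `𝓜_{+,1}` and has finite energy, and `∞` otherwise. -/
noncomputable def rate (c : Config → ℝ) (T : ℝ) (π : ℝ → SubProb) : EReal :=
  if (∀ t ∈ Icc (0 : ℝ) T, π t ∈ SubProbOne) ∧ energy T π < ⊤ then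
    ⨆ G : TestC12 T, (rateFunctional c T π G : EReal)
  else ⊤

open Classical in
/-- `I_T(π|γ)`: the rate function with prescribed initial profile. -/
noncomputable def rateFrom (c : Config → ℝ) (T : ℝ) (π : ℝ → SubProb) (γ : Profile) : EReal :=
  if π 0 = γ.toSubProb then rate c T π else ⊤

/-! ### Quasi-potentials -/

/-- The set `{ϱ̄(dθ - ω) : ω ∈ 𝕋}` of translates of `ϱ̄(dθ) = γ(θ) dθ`. -/
def translates (γ : Profile) : Set SubProb := {ϱ | ∃ ω : Torus, ϱ = (γ.translate ω).toSubProb}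

/-- The minimal cost to create the measure `ϱ` starting from a set `M` of measures. -/
noncomputable def quasiPotential (c : Config → ℝ) (M : Set SubProb) (ϱ : SubProb) : EReal :=
  ⨅ (T : ℝ) (_ : 0 < T) (γ : Profile) (_ : γ.toSubProb ∈ M) (π : ℝ → SubProb)
    (_ : IsCadlag T π) (_ : π T = ϱ), rateFrom c T π γ

/-- The cost `v_{ij} = V_i(ϱ̄_j)`, where `ϱ̄_j(dθ) = ρ̄_j(θ) dθ` and `𝓜_i` is the set of translates
of `ϱ̄_i`. -/
noncomputable def transitionCost (c : Config → ℝ) {l : ℕ} (ρbar : Fin l → Profile)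
    (i j : Fin l) : EReal :=
  quasiPotential c (translates (ρbar i)) (ρbar j).toSubProb

end ReactionDiffusion

open ReactionDiffusion

namespace ReactionDiffusion

/-! ### Birth and death rates -/

/-! The rate functional vanishes along solutions of the equation, so a heteroclinic orbit travels
for free from a profile close to `φ` to a profile close to `ψ`. It reaches neither in finite time,
so two end pieces are added: linear interpolations, each of duration one, from `φ` to the orbit at a
very negative time and from the orbit at a large time to `ψ`. If both end pieces cost at most `ε /
2`, the concatenated path costs at most `ε`. As costs are nonnegative (test with `G = 0`), the
quasi-potential at `ψ` is zero.

Cheapness of the end pieces (`cheapPath_interp`, `exists_cheapPath_interp`) rests on two facts. By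
the maximum principle stationary solutions stay away from `0` and `1`, so near them birth rate,
death rate and mobility have positive lower bounds, and the supremum over `G` is dominated by that
of a concave quadratic in `G` and `∇G`. Moreover the Laplacian is integrated by parts once and
compared with the stationary equation, so that only first derivatives of the difference of the
endpoints enter. Convergence in `C¹` therefore suffices.

Freeness of the orbit has two components. Inserting the weak formulation into the functional leaves
an integrand which is nonpositive because `exp g ≥ 1 + g` (`IsEntireSolution.cost_nonpos`). The path
must also be weakly continuous and have finite energy, which for weak solutions needs proof.
Pairings with Fourier modes are Lipschitz in time, and density of trigonometric polynomials gives
weak continuity. The parabolic energy estimate, carried out mode by mode and summed by Parseval's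
identity, bounds the Dirichlet energy integrated over time (`lintegral_dirichlet_le`), and this
controls the energy functional.

Finally the equation is translation invariant. Translating the orbit moves its target to any point
of `𝓜_j` while its source remains in `𝓜_i`, so `V_i` vanishes on all of `𝓜_j`. -/

instance (r : ℝ) : IsProbabilityMeasure (bernoulliProduct r) := by
  unfold bernoulliProduct; infer_instance

theorem IsCylinder.exists_restrict {f : Config → ℝ} (hf : IsCylinder f) :
    ∃ (s : Finset ℤ) (g : (s → Bool) → ℝ), ∀ η, f η = g (s.restrict η) := by
  obtain ⟨s, hs⟩ := hf
  -- The value `false` outside `s` is arbitrary, since `f` does not see these coordinates.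
  refine ⟨s, fun y => f (fun i => if h : i ∈ s then y ⟨i, h⟩ else false), fun η => hs ?_⟩
  intro i hi
  have hi' : i ∈ s := hi
  simp [hi']

theorem IsCylinder.measurable {f : Config → ℝ} (hf : IsCylinder f) : Measurable f := by
  obtain ⟨s, g, hg⟩ := hf.exists_restrict
  have : f = g ∘ s.restrict := funext hg
  rw [this]
  exact (measurable_of_finite g).comp (Finset.measurable_restrict s)

theorem IsCylinder.finite_range {f : Config → ℝ} (hf : IsCylinder f) : (range f).Finite := by
  obtain ⟨s, g, hg⟩ := hf.exists_restrict
  refine (Set.finite_range g).subset ?_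
  rintro _ ⟨η, rfl⟩
  exact ⟨_, (hg η).symm⟩

theorem IsCylinder.integrable {f : Config → ℝ} (hf : IsCylinder f) (r : ℝ) :
    Integrable f (bernoulliProduct r) := by
  obtain ⟨C, hC⟩ := (hf.finite_range.image norm).bddAbove
  refine Integrable.of_bound hf.measurable.aestronglyMeasurable C (ae_of_all _ fun η => ?_)
  exact hC ⟨_, ⟨η, rfl⟩, rfl⟩

/-- Only finitely many coordinates matter, so the integral is a finite sum of polynomials in the
clamped density. -/
theorem IsCylinder.continuous_integral {f : Config → ℝ} (hf : IsCylinder f) :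
    Continuous fun r => ∫ η, f η ∂(bernoulliProduct r) := by
  obtain ⟨s, g, hg⟩ := hf.exists_restrict
  have h1 : ∀ r, ∫ η, f η ∂(bernoulliProduct r) =
      ∑ x : s → Bool, (∏ i, (if x i then (projIcc (0 : ℝ) 1 zero_le_one r : ℝ)
        else 1 - (projIcc (0 : ℝ) 1 zero_le_one r : ℝ))) * g x := by
    intro r
    simp_rw [hg]
    unfold bernoulliProduct
    rw [integral_restrict_infinitePi (X := fun _ : ℤ => Bool) (f := g)
      _ (measurable_of_finite g).aestronglyMeasurable, integral_fintype Integrable.of_finite]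
    refine Finset.sum_congr rfl fun x _ => ?_
    rw [smul_eq_mul, measureReal_def, Measure.pi_singleton, ENNReal.toReal_prod]
    congr 1
    refine Finset.prod_congr rfl fun i _ => ?_
    rw [← measureReal_def,
      ProbabilityTheory.bernoulliMeasure_real_apply _ (measurableSet_singleton _)]
    generalize projIcc (0 : ℝ) 1 zero_le_one r = q
    rcases x i <;> simp
  rw [funext h1]
  refine continuous_finsetSum _ fun x _ => Continuous.mul (continuous_finsetProd _ fun i _ => ?_)
    continuous_const
  split_ifs
  · exact continuous_subtype_val.comp continuous_projIcc
  · exact continuous_const.sub (continuous_subtype_val.comp continuous_projIcc)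

theorem IsCylinder.mul {f g : Config → ℝ} (hf : IsCylinder f) (hg : IsCylinder g) :
    IsCylinder fun η => f η * g η := by
  classical
  obtain ⟨s, hs⟩ := hf
  obtain ⟨t, ht⟩ := hg
  refine ⟨s ∪ t, fun x y hxy => ?_⟩
  have h1 := hs (fun i hi => hxy i (by simp [Finset.mem_coe.1 hi]))
  have h2 := ht (fun i hi => hxy i (by simp [Finset.mem_coe.1 hi]))
  simp only [h1, h2]

theorem isCylinder_zero_site (f : Bool → ℝ) : IsCylinder fun η => f (η 0) :=
  ⟨{0}, fun x y hxy => congrArg f (hxy 0 (by simp))⟩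

theorem continuous_birth {c : Config → ℝ} (hc : IsCylinder c) : Continuous (birth c) :=
  ((isCylinder_zero_site fun b => 1 - occ b).mul hc).continuous_integral

theorem continuous_death {c : Config → ℝ} (hc : IsCylinder c) : Continuous (death c) :=
  ((isCylinder_zero_site occ).mul hc).continuous_integral

theorem continuous_reaction {c : Config → ℝ} (hc : IsCylinder c) : Continuous (reaction c) :=
  (continuous_birth hc).sub (continuous_death hc)

theorem integral_zero_site (f : Bool → ℝ) {r : ℝ} (hr : r ∈ Icc (0 : ℝ) 1) :
    ∫ η, f (η 0) ∂(bernoulliProduct r) = r * f true + (1 - r) * f false := by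
  have h := measurePreserving_eval_infinitePi (fun _ : ℤ =>
    ProbabilityTheory.bernoulliMeasure true false (projIcc (0 : ℝ) 1 zero_le_one r)) 0
  have h2 : ∫ η, f (η 0) ∂(bernoulliProduct r) = ∫ b, f b ∂(ProbabilityTheory.bernoulliMeasure
      true false (projIcc (0 : ℝ) 1 zero_le_one r)) := by
    rw [← h.map_eq, integral_map h.measurable.aemeasurable
      (measurable_of_finite f).aestronglyMeasurable]
    rfl
  rw [h2, ProbabilityTheory.integral_bernoulliMeasure, projIcc_of_mem _ hr]
  simp

theorem integral_zero_site_mul_bounds {c : Config → ℝ} (hc : IsCylinder c) {m M : ℝ}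
    (hm : ∀ η, m ≤ c η) (hM : ∀ η, c η ≤ M) {f : Bool → ℝ} (hf : ∀ b, 0 ≤ f b) {r : ℝ}
    (hr : r ∈ Icc (0 : ℝ) 1) :
    m * (r * f true + (1 - r) * f false) ≤ ∫ η, f (η 0) * c η ∂(bernoulliProduct r) ∧
    ∫ η, f (η 0) * c η ∂(bernoulliProduct r) ≤ M * (r * f true + (1 - r) * f false) := by
  have hi := ((isCylinder_zero_site f).mul hc).integrable r
  have hi' := (isCylinder_zero_site f).integrable r
  rw [← integral_zero_site f hr, ← integral_const_mul, ← integral_const_mul]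
  exact ⟨integral_mono (hi'.const_mul _) hi fun η => by
      have := mul_le_mul_of_nonneg_left (hm η) (hf (η 0)); simp only; linarith,
    integral_mono hi (hi'.const_mul _) fun η => by
      have := mul_le_mul_of_nonneg_left (hM η) (hf (η 0)); simp only; linarith⟩

/-- Strictly positive cylinder rates give birth and death rates comparable with `1 - r` and `r`. -/
theorem exists_birth_death_bounds {c : Config → ℝ} (hpos : ∀ η, 0 < c η) (hc : IsCylinder c) :
    ∃ m M : ℝ, 0 < m ∧ 0 < M ∧ ∀ r ∈ Icc (0 : ℝ) 1,
      m * (1 - r) ≤ birth c r ∧ birth c r ≤ M * (1 - r) ∧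
      m * r ≤ death c r ∧ death c r ≤ M * r := by
  -- A cylinder function takes finitely many values, so its extreme values are attained and the
  -- lower one is strictly positive.
  obtain ⟨a, ⟨ηa, rfl⟩, ha⟩ := hc.finite_range.exists_minimal (range_nonempty c)
  obtain ⟨b, ⟨ηb, rfl⟩, hb⟩ := hc.finite_range.exists_maximal (range_nonempty c)
  have hm : ∀ η, c ηa ≤ c η := fun η => by
    by_contra h
    exact h (ha ⟨η, rfl⟩ (le_of_not_ge h))
  have hM : ∀ η, c η ≤ c ηb := fun η => by
    by_contra h
    exact h (hb ⟨η, rfl⟩ (le_of_not_ge h))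
  refine ⟨c ηa, c ηb, hpos _, hpos _, fun r hr => ?_⟩
  have h1 : _ ≤ birth c r ∧ birth c r ≤ _ := integral_zero_site_mul_bounds hc hm hM
    (f := fun b => 1 - occ b) (fun b => by cases b <;> simp [occ]) hr
  have h2 : _ ≤ death c r ∧ death c r ≤ _ := integral_zero_site_mul_bounds hc hm hM (f := occ)
    (fun b => by cases b <;> simp [occ]) hr
  simp only [occ, if_true, Bool.false_eq_true, if_false, sub_self, sub_zero, mul_zero, mul_one,
    zero_add, add_zero] at h1 h2
  exact ⟨h1.1, h1.2, h2.1, h2.2⟩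

/-! ### Differentiation on the torus -/

/-- `f'` is the continuous derivative of `f` on the torus. -/
structure HasDx (f f' : Torus → ℝ) : Prop where
  cont : Continuous f'
  deriv : ∀ x : ℝ, HasDerivAt (lift f) (lift f' x) x

theorem continuous_of_lift {f : Torus → ℝ} (h : Continuous (lift f)) : Continuous f :=
  (QuotientAddGroup.isQuotientMap_mk _).continuous_iff.2 h

theorem continuous_lift {f : Torus → ℝ} (h : Continuous f) : Continuous (lift f) :=
  h.comp continuous_quotient_mk'

theorem HasDx.continuous {f f' : Torus → ℝ} (h : HasDx f f') : Continuous f :=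
  continuous_of_lift (continuous_iff_continuousAt.2 fun x => (h.deriv x).continuousAt)

theorem HasDx.deriv_lift {f f' : Torus → ℝ} (h : HasDx f f') : _root_.deriv (lift f) = lift f' :=
  funext fun x => (h.deriv x).deriv

theorem lift_periodic (f : Torus → ℝ) : Function.Periodic (lift f) 1 := fun x => by
  simp [lift]

theorem exists_lift_eq {g : ℝ → ℝ} (hg : Function.Periodic g 1) : ∃ f : Torus → ℝ, lift f = g :=
  ⟨hg.lift, funext fun x => hg.lift_coe x⟩

theorem exists_hasDx {f : Torus → ℝ} (hf : ContDiff ℝ 1 (lift f)) : ∃ f', HasDx f f' := by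
  have hd : Differentiable ℝ (lift f) := hf.differentiable (by simp)
  have hper : Function.Periodic (_root_.deriv (lift f)) 1 := fun x => by
    have : (fun y => lift f (y + 1)) = lift f := funext (lift_periodic f)
    rw [← deriv_comp_add_const, this]
  obtain ⟨f', hf'⟩ := exists_lift_eq hper
  refine ⟨f', continuous_of_lift ?_, fun x => ?_⟩
  · rw [hf']; exact hf.continuous_deriv (by simp)
  · rw [hf']; exact (hd x).hasDerivAt

theorem HasDx.add {f f' g g' : Torus → ℝ} (hf : HasDx f f') (hg : HasDx g g') :
    HasDx (fun θ => f θ + g θ) (fun θ => f' θ + g' θ) :=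
  ⟨hf.cont.add hg.cont, fun x => (hf.deriv x).add (hg.deriv x)⟩

theorem HasDx.const_mul {f f' : Torus → ℝ} (a : ℝ) (hf : HasDx f f') :
    HasDx (fun θ => a * f θ) (fun θ => a * f' θ) :=
  ⟨hf.cont.const_mul a, fun x => (hf.deriv x).const_mul a⟩

theorem integrable_of_continuous {f : Torus → ℝ} (hf : Continuous f) : Integrable f :=
  hf.integrable_of_hasCompactSupport (HasCompactSupport.of_compactSpace f)

/-- Integration by parts on the torus. -/
theorem HasDx.integral_mul {f f' g g' : Torus → ℝ} (hf : HasDx f f') (hg : HasDx g g') :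
    ∫ θ, f θ * g' θ = -∫ θ, f' θ * g θ := by
  rw [← UnitAddCircle.intervalIntegral_preimage 0, ← UnitAddCircle.intervalIntegral_preimage 0]
  have := intervalIntegral.integral_mul_deriv_eq_deriv_mul (a := 0) (b := 0 + 1)
    (fun x _ => hf.deriv x) (fun x _ => hg.deriv x)
    ((continuous_lift hf.cont).intervalIntegrable _ _)
    ((continuous_lift hg.cont).intervalIntegrable _ _)
  -- The integral runs over one full period, so the two boundary terms cancel.
  rw [lift_periodic f 0, lift_periodic g 0] at this
  simp only [lift] at this
  rw [this]; ring

/-! ### Stationary solutions -/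

theorem exists_hasDx_of_stationary {c : Config → ℝ} {φ : Profile} (hφ : φ ∈ Stationary c) :
    ∃ φ' φ'', HasDx φ φ' ∧ HasDx φ' φ'' ∧ ∀ θ, φ'' θ = -2 * reaction c (φ θ) := by
  obtain ⟨h2, heq⟩ := hφ
  obtain ⟨φ', h'⟩ := exists_hasDx (h2.of_le (by norm_num))
  have h1 : ContDiff ℝ 1 (lift φ') := by
    rw [← h'.deriv_lift]
    exact ((contDiff_succ_iff_deriv (n := 1)).1 h2).2.2
  obtain ⟨φ'', h''⟩ := exists_hasDx h1
  refine ⟨φ', φ'', h', h'', fun θ => ?_⟩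
  induction θ using QuotientAddGroup.induction_on with | _ x =>
  have := heq x
  rw [iteratedDeriv_succ, iteratedDeriv_one, h'.deriv_lift, h''.deriv_lift] at this
  simp only [lift] at this
  linarith

/-- If the second derivative were negative, the point would also be a local maximum. The function
would then be locally constant, with zero second derivative. -/
theorem deriv_deriv_nonneg_of_isLocalMin {f : ℝ → ℝ} {x : ℝ} (h : IsLocalMin f x)
    (hc : ContinuousAt f x) : 0 ≤ deriv (deriv f) x := by
  by_contra hneg
  have hmax := isLocalMax_of_deriv_deriv_neg (not_le.1 hneg) h.deriv_eq_zero hc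
  have hev : f =ᶠ[𝓝 x] fun _ => f x := by
    filter_upwards [h, hmax] with y h1 h2 using le_antisymm h2 h1
  have := hev.deriv.deriv_eq
  simp at this
  exact hneg this.ge

theorem deriv_deriv_nonpos_of_isLocalMax {f : ℝ → ℝ} {x : ℝ} (h : IsLocalMax f x)
    (hc : ContinuousAt f x) : deriv (deriv f) x ≤ 0 := by
  have := deriv_deriv_nonneg_of_isLocalMin (f := fun y => -f y) h.neg hc.neg
  simp only [deriv.fun_neg'] at this
  simpa using this

/-- By the maximum principle, stationary solutions are bounded away from `0` and `1`. -/
theorem exists_stationary_bounds {c : Config → ℝ} (hpos : ∀ η, 0 < c η) (hc : IsCylinder c)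
    {φ : Profile} (hφ : φ ∈ Stationary c) : ∃ δ > 0, ∀ θ, δ ≤ φ θ ∧ φ θ ≤ 1 - δ := by
  obtain ⟨φ', φ'', h', h'', heq⟩ := exists_hasDx_of_stationary hφ
  obtain ⟨m, M, hm, hM, hb⟩ := exists_birth_death_bounds hpos hc
  obtain ⟨θ₀, -, hmin⟩ := isCompact_univ.exists_isMinOn univ_nonempty h'.continuous.continuousOn
  obtain ⟨θ₁, -, hmax⟩ := isCompact_univ.exists_isMaxOn univ_nonempty h'.continuous.continuousOn
  have h0 : 0 < φ θ₀ := by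
    refine lt_of_le_of_ne (φ.mem_Icc _).1 fun h0 => ?_
    obtain ⟨x, rfl⟩ := QuotientAddGroup.mk_surjective θ₀
    have hl : IsLocalMin (lift φ) x := Eventually.of_forall fun y => hmin (mem_univ _)
    have := deriv_deriv_nonneg_of_isLocalMin hl (h'.deriv x).continuousAt
    rw [h'.deriv_lift, h''.deriv_lift, lift] at this
    have e := heq (x : Torus)
    -- At density `0` the death rate vanishes and the birth rate is at least `m`, so `F` is positive
    -- there. The stationary equation then forces a negative second derivative at a minimum.
    have := hb 0 (by simp)
    rw [← show (0:ℝ) = φ (x : Torus) from h0] at e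
    simp only [reaction] at e
    linarith
  have h1 : φ θ₁ < 1 := by
    refine lt_of_le_of_ne (φ.mem_Icc _).2 fun h0 => ?_
    obtain ⟨x, rfl⟩ := QuotientAddGroup.mk_surjective θ₁
    have hl : IsLocalMax (lift φ) x := Eventually.of_forall fun y => hmax (mem_univ _)
    have := deriv_deriv_nonpos_of_isLocalMax hl (h'.deriv x).continuousAt
    rw [h'.deriv_lift, h''.deriv_lift, lift] at this
    have e := heq (x : Torus)
    -- Symmetrically, at density `1` only death survives and `F` is negative.
    have := hb 1 (by simp)
    rw [show φ (x : Torus) = 1 from h0] at e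
    simp only [reaction] at e
    linarith
  refine ⟨min (φ θ₀) (1 - φ θ₁), lt_min h0 (by linarith), fun θ => ⟨(min_le_left _ _).trans
    (hmin (mem_univ θ)), ?_⟩⟩
  have h2 := min_le_right (φ θ₀) (1 - φ θ₁)
  have h3 : φ θ ≤ φ θ₁ := hmax (mem_univ θ)
  linarith

/-! ### Integration over space-time layers -/

/-- Lebesgue measure on `[0,T] × 𝕋`. -/
noncomputable def layer (T : ℝ) : Measure (ℝ × Torus) := (volume.restrict (Ioc 0 T)).prod volume

instance (T : ℝ) : IsFiniteMeasure (layer T) := by unfold layer; infer_instance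

theorem layer_eq (T : ℝ) : layer T = volume.restrict (Ioc 0 T ×ˢ (univ : Set Torus)) := by
  rw [layer, Measure.volume_eq_prod, ← Measure.prod_restrict, Measure.restrict_univ]

theorem ae_layer (T : ℝ) : ∀ᵐ p ∂(layer T), p ∈ Icc 0 T ×ˢ (univ : Set Torus) := by
  rw [layer_eq]
  filter_upwards [ae_restrict_mem (measurableSet_Ioc.prod MeasurableSet.univ)] with p hp
  exact ⟨Ioc_subset_Icc_self hp.1, hp.2⟩

/-- Bounded measurable functions on the layer `[0,T] × 𝕋`. -/
structure BddMeas (T : ℝ) (f : ℝ × Torus → ℝ) : Prop where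
  meas : AEStronglyMeasurable f (layer T)
  bdd : ∃ C, ∀ p ∈ Icc 0 T ×ˢ (univ : Set Torus), |f p| ≤ C

namespace BddMeas

variable {T : ℝ} {f g : ℝ × Torus → ℝ}

theorem integrable (hf : BddMeas T f) : Integrable f (layer T) := by
  obtain ⟨C, hC⟩ := hf.bdd
  refine Integrable.of_bound hf.meas C ?_
  filter_upwards [ae_layer T] with p hp using hC p hp

theorem of_continuousOn (hf : ContinuousOn f (Icc 0 T ×ˢ univ)) : BddMeas T f := by
  constructor
  · rw [layer_eq]
    exact (hf.mono (prod_mono Ioc_subset_Icc_self subset_rfl)).aestronglyMeasurable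
      (measurableSet_Ioc.prod MeasurableSet.univ)
  · obtain ⟨C, hC⟩ := (isCompact_Icc.prod isCompact_univ).exists_bound_of_continuousOn hf
    exact ⟨C, hC⟩

theorem comp (hf : BddMeas T f) {Φ : ℝ → ℝ} (hΦ : Continuous Φ) : BddMeas T fun p => Φ (f p) := by
  refine ⟨hΦ.comp_aestronglyMeasurable hf.meas, ?_⟩
  obtain ⟨C, hC⟩ := hf.bdd
  obtain ⟨K, hK⟩ := (isCompact_Icc (a := -C) (b := C)).exists_bound_of_continuousOn hΦ.continuousOn
  exact ⟨K, fun p hp => hK _ (abs_le.1 (hC p hp))⟩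

theorem add (hf : BddMeas T f) (hg : BddMeas T g) : BddMeas T fun p => f p + g p := by
  refine ⟨hf.meas.add hg.meas, ?_⟩
  obtain ⟨C, hC⟩ := hf.bdd
  obtain ⟨K, hK⟩ := hg.bdd
  exact ⟨C + K, fun p hp => (abs_add_le _ _).trans (add_le_add (hC p hp) (hK p hp))⟩

theorem mul (hf : BddMeas T f) (hg : BddMeas T g) : BddMeas T fun p => f p * g p := by
  refine ⟨hf.meas.mul hg.meas, ?_⟩
  obtain ⟨C, hC⟩ := hf.bdd
  obtain ⟨K, hK⟩ := hg.bdd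
  refine ⟨C * K, fun p hp => ?_⟩
  rw [abs_mul]
  exact mul_le_mul (hC p hp) (hK p hp) (abs_nonneg _) ((abs_nonneg _).trans (hC p hp))

theorem const_mul (hf : BddMeas T f) (a : ℝ) : BddMeas T fun p => a * f p :=
  hf.comp (Φ := fun x => a * x) (by fun_prop)

theorem neg (hf : BddMeas T f) : BddMeas T fun p => -f p :=
  hf.comp (Φ := fun x => -x) (by fun_prop)

theorem sub (hf : BddMeas T f) (hg : BddMeas T g) : BddMeas T fun p => f p - g p := by
  simpa only [sub_eq_add_neg] using hf.add hg.neg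

theorem integral_eq (hf : BddMeas T f) (hT : 0 ≤ T) :
    ∫ t in 0..T, ∫ θ, f (t, θ) = ∫ p, f p ∂(layer T) := by
  rw [intervalIntegral.integral_of_le hT, layer, integral_prod]
  exact hf.integrable

theorem intervalIntegrable (hf : BddMeas T f) (hT : 0 ≤ T) :
    IntervalIntegrable (fun t => ∫ θ, f (t, θ)) volume 0 T := by
  rw [intervalIntegrable_iff_integrableOn_Ioc_of_le hT]
  exact hf.integrable.integral_prod_left

theorem integral_swap (hf : BddMeas T f) (hT : 0 ≤ T) :
    ∫ θ, ∫ t in 0..T, f (t, θ) = ∫ p, f p ∂(layer T) := by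
  simp_rw [intervalIntegral.integral_of_le hT]
  rw [layer, integral_prod_symm]
  exact hf.integrable

theorem integral_mono (hf : BddMeas T f) (hg : BddMeas T g)
    (h : ∀ p ∈ Icc 0 T ×ˢ (univ : Set Torus), f p ≤ g p) :
    ∫ p, f p ∂(layer T) ≤ ∫ p, g p ∂(layer T) := by
  refine integral_mono_ae hf.integrable hg.integrable ?_
  filter_upwards [ae_layer T] with p hp using h p hp

end BddMeas

theorem layer_real_univ {T : ℝ} (hT : 0 ≤ T) : (layer T).real univ = T := by
  rw [layer, ← univ_prod_univ, measureReal_prod_prod]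
  simp [measureReal_def, hT]

theorem bddMeas_profile {u : ℝ → Profile} (hu : Measurable fun p : ℝ × Torus => u p.1 p.2)
    (T : ℝ) : BddMeas T fun p => u p.1 p.2 :=
  ⟨hu.aestronglyMeasurable, 1, fun p _ => by
    have := (u p.1).mem_Icc p.2
    rw [abs_le]; exact ⟨by linarith [this.1], this.2⟩⟩

/-! ### Densities -/

theorem Profile.integrable_mul (γ : Profile) {f : Torus → ℝ} (hf : Integrable f) :
    Integrable fun θ => γ θ * f θ := by
  refine hf.bdd_mul (c := 1) γ.measurable_toFun.aestronglyMeasurable (ae_of_all _ fun θ => ?_)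
  have := γ.mem_Icc θ
  rw [Real.norm_eq_abs, abs_le]; exact ⟨by linarith [this.1], this.2⟩

theorem Profile.integral_meas (γ : Profile) (f : Torus → ℝ) :
    ∫ θ, f θ ∂γ.toSubProb.meas = ∫ θ, γ θ * f θ := by
  change ∫ θ, f θ ∂(volume.withDensity fun θ => ENNReal.ofReal (γ θ)) = _
  rw [integral_withDensity_eq_integral_toReal_smul₀
    γ.measurable_toFun.ennreal_ofReal.aemeasurable (ae_of_all _ fun _ => ENNReal.ofReal_lt_top)]
  refine integral_congr_ae (ae_of_all _ fun θ => ?_)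
  simp [ENNReal.toReal_ofReal (γ.mem_Icc θ).1]

theorem Profile.density_ae (γ : Profile) : γ.toSubProb.density =ᵐ[volume] γ := by
  have h : γ.toSubProb.meas.rnDeriv volume =ᵐ[volume] fun θ => ENNReal.ofReal (γ θ) :=
    Measure.rnDeriv_withDensity volume γ.measurable_toFun.ennreal_ofReal
  filter_upwards [h] with θ hθ
  rw [SubProb.density, hθ, ENNReal.toReal_ofReal (γ.mem_Icc θ).1]

theorem Profile.integral_density (γ : Profile) (f : ℝ → Torus → ℝ) :
    ∫ θ, f (γ.toSubProb.density θ) θ = ∫ θ, f (γ θ) θ := by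
  refine integral_congr_ae ?_
  filter_upwards [γ.density_ae] with θ hθ
  rw [hθ]

theorem Profile.toSubProb_eq_iff {γ γ' : Profile} :
    γ.toSubProb = γ'.toSubProb ↔ (γ : Torus → ℝ) =ᵐ[volume] γ' := by
  constructor
  · intro h
    have h1 := γ.density_ae
    rw [h] at h1
    exact h1.symm.trans γ'.density_ae
  · intro h
    refine Subtype.ext (Subtype.ext ?_)
    refine withDensity_congr_ae ?_
    filter_upwards [h] with θ hθ
    rw [hθ]

/-! ### The rate functional on densities -/

/-- The space-time integrand of the rate functional. -/
noncomputable def costDensity (c : Config → ℝ) {T : ℝ} (u : ℝ → Profile) (G : TestC12 T)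
    (p : ℝ × Torus) : ℝ :=
  u p.1 p.2 * (G.dt p.1 p.2 + 1 / 2 * G.dxx p.1 p.2)
    + 1 / 2 * (mobility (u p.1 p.2) * G.dx p.1 p.2 ^ 2)
    + (birth c (u p.1 p.2) * (Real.exp (G.fn p.1 p.2) - 1)
      + death c (u p.1 p.2) * (Real.exp (-G.fn p.1 p.2) - 1))

theorem continuous_mobility : Continuous mobility := by unfold mobility; fun_prop

section
variable {c : Config → ℝ} {T : ℝ} {u : ℝ → Profile}

theorem TestC12.bddMeas_fn (G : TestC12 T) : BddMeas T fun p => G.fn p.1 p.2 :=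
  .of_continuousOn G.cont_fn
theorem TestC12.bddMeas_dt (G : TestC12 T) : BddMeas T fun p => G.dt p.1 p.2 :=
  .of_continuousOn G.cont_dt
theorem TestC12.bddMeas_dx (G : TestC12 T) : BddMeas T fun p => G.dx p.1 p.2 :=
  .of_continuousOn G.cont_dx
theorem TestC12.bddMeas_dxx (G : TestC12 T) : BddMeas T fun p => G.dxx p.1 p.2 :=
  .of_continuousOn G.cont_dxx
theorem TestC01.bddMeas_fn (G : TestC01 T) : BddMeas T fun p => G.fn p.1 p.2 :=
  .of_continuousOn G.cont_fn
theorem TestC01.bddMeas_dx (G : TestC01 T) : BddMeas T fun p => G.dx p.1 p.2 :=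
  .of_continuousOn G.cont_dx

theorem bddMeas_exp_term (hc : IsCylinder c)
    (hu : Measurable fun p : ℝ × Torus => u p.1 p.2) (G : TestC12 T) :
    BddMeas T fun p => birth c (u p.1 p.2) * (Real.exp (G.fn p.1 p.2) - 1) +
      death c (u p.1 p.2) * (Real.exp (-G.fn p.1 p.2) - 1) :=
  (((bddMeas_profile hu T).comp (continuous_birth hc)).mul
    (G.bddMeas_fn.comp (Φ := fun x => Real.exp x - 1) (by fun_prop))).add
  (((bddMeas_profile hu T).comp (continuous_death hc)).mul
    (G.bddMeas_fn.comp (Φ := fun x => Real.exp (-x) - 1) (by fun_prop)))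

theorem bddMeas_dx_term (hu : Measurable fun p : ℝ × Torus => u p.1 p.2) (G : TestC12 T) :
    BddMeas T fun p => mobility (u p.1 p.2) * G.dx p.1 p.2 ^ 2 :=
  ((bddMeas_profile hu T).comp continuous_mobility).mul
    (G.bddMeas_dx.comp (Φ := fun x => x ^ 2) (by fun_prop))

theorem bddMeas_linear_term (hu : Measurable fun p : ℝ × Torus => u p.1 p.2) (G : TestC12 T) :
    BddMeas T fun p => u p.1 p.2 * (G.dt p.1 p.2 + 1 / 2 * G.dxx p.1 p.2) :=
  (bddMeas_profile hu T).mul (G.bddMeas_dt.add (G.bddMeas_dxx.const_mul _))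

theorem bddMeas_costDensity (hc : IsCylinder c)
    (hu : Measurable fun p : ℝ × Torus => u p.1 p.2) (G : TestC12 T) :
    BddMeas T (costDensity c u G) :=
  ((bddMeas_linear_term hu G).add ((bddMeas_dx_term hu G).const_mul _)).add
    (bddMeas_exp_term hc hu G)

theorem integral_exp_term (γ : Profile) (hc : IsCylinder c) {g : Torus → ℝ} (hg : Continuous g) :
    (∫ θ, birth c (γ θ) * (Real.exp (g θ) - 1)) + ∫ θ, death c (γ θ) * (Real.exp (-g θ) - 1) =
    ∫ θ, (birth c (γ θ) * (Real.exp (g θ) - 1) + death c (γ θ) * (Real.exp (-g θ) - 1)) := by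
  have key : ∀ Φ : ℝ → ℝ, Continuous Φ → ∀ f : Torus → ℝ, Continuous f →
      Integrable fun θ => Φ (γ θ) * f θ := by
    intro Φ hΦ f hf
    obtain ⟨K, hK⟩ := (isCompact_Icc (a := (0 : ℝ)) (b := 1)).exists_bound_of_continuousOn
      hΦ.continuousOn
    exact (integrable_of_continuous hf).bdd_mul (c := K)
      (hΦ.measurable.comp γ.measurable_toFun).aestronglyMeasurable
      (ae_of_all _ fun θ => hK _ (γ.mem_Icc θ))
  rw [integral_add (key _ (continuous_birth hc) _ (by fun_prop))
    (key _ (continuous_death hc) _ (by fun_prop))]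

theorem continuous_section {f : ℝ → Torus → ℝ}
    (hf : ContinuousOn (fun p : ℝ × Torus => f p.1 p.2) (Icc 0 T ×ˢ univ)) {t : ℝ}
    (ht : t ∈ Icc 0 T) : Continuous (f t) :=
  continuousOn_univ.1 (hf.comp (f := fun θ : Torus => (t, θ)) (by fun_prop)
    fun θ _ => ⟨ht, mem_univ _⟩)

/-- Collecting all time-dependent terms into one space-time integral allows costs to be estimated
pointwise. Radon–Nikodym densities are replaced by the given profiles, which they equal almost
everywhere. -/
theorem rateFunctional_toSubProb (hc : IsCylinder c) (hT : 0 ≤ T)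
    (hu : Measurable fun p : ℝ × Torus => u p.1 p.2) (G : TestC12 T) :
    rateFunctional c T (fun t => (u t).toSubProb) G =
      (∫ θ, u T θ * G.fn T θ) - (∫ θ, u 0 θ * G.fn 0 θ) - ∫ p, costDensity c u G p ∂(layer T) := by
  unfold rateFunctional
  simp only [Profile.integral_meas]
  have e1 : ∀ t, ∫ θ, mobility ((u t).toSubProb.density θ) * G.dx t θ ^ 2 =
      ∫ θ, mobility (u t θ) * G.dx t θ ^ 2 := fun t =>
    (u t).integral_density fun r θ => mobility r * G.dx t θ ^ 2
  have e2 : ∀ t, ∫ θ, birth c ((u t).toSubProb.density θ) * (Real.exp (G.fn t θ) - 1) =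
      ∫ θ, birth c (u t θ) * (Real.exp (G.fn t θ) - 1) := fun t =>
    (u t).integral_density fun r θ => birth c r * (Real.exp (G.fn t θ) - 1)
  have e3 : ∀ t, ∫ θ, death c ((u t).toSubProb.density θ) * (Real.exp (-G.fn t θ) - 1) =
      ∫ θ, death c (u t θ) * (Real.exp (-G.fn t θ) - 1) := fun t =>
    (u t).integral_density fun r θ => death c r * (Real.exp (-G.fn t θ) - 1)
  simp only [e1, e2, e3]
  have e4 : ∫ t in 0..T, ((∫ θ, birth c (u t θ) * (Real.exp (G.fn t θ) - 1))
      + ∫ θ, death c (u t θ) * (Real.exp (-G.fn t θ) - 1)) =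
      ∫ p, (birth c (u p.1 p.2) * (Real.exp (G.fn p.1 p.2) - 1)
      + death c (u p.1 p.2) * (Real.exp (-G.fn p.1 p.2) - 1)) ∂(layer T) := by
    rw [← (bddMeas_exp_term hc hu G).integral_eq hT]
    refine intervalIntegral.integral_congr fun t ht => ?_
    rw [uIcc_of_le hT] at ht
    exact integral_exp_term (u t) hc (continuous_section G.cont_fn ht)
  rw [e4, (bddMeas_linear_term hu G).integral_eq hT, (bddMeas_dx_term hu G).integral_eq hT]
  unfold costDensity
  rw [integral_add (((bddMeas_linear_term hu G).add
    ((bddMeas_dx_term hu G).const_mul _)).integrable) (bddMeas_exp_term hc hu G).integrable,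
    integral_add (bddMeas_linear_term hu G).integrable
      ((bddMeas_dx_term hu G).const_mul _).integrable, integral_const_mul]
  ring

theorem energyFunctional_toSubProb (hT : 0 ≤ T)
    (hu : Measurable fun p : ℝ × Torus => u p.1 p.2) (G : TestC01 T) :
    energyFunctional T (fun t => (u t).toSubProb) G =
      ∫ p, (2 * (u p.1 p.2 * G.dx p.1 p.2) - G.fn p.1 p.2 ^ 2) ∂(layer T) := by
  unfold energyFunctional
  have e1 : ∀ t, ∫ θ, (u t).toSubProb.density θ * G.dx t θ = ∫ θ, u t θ * G.dx t θ := fun t =>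
    (u t).integral_density fun r θ => r * G.dx t θ
  have h1 : BddMeas T fun p => u p.1 p.2 * G.dx p.1 p.2 := (bddMeas_profile hu T).mul G.bddMeas_dx
  have h2 : BddMeas T fun p => G.fn p.1 p.2 ^ 2 :=
    G.bddMeas_fn.comp (Φ := fun x => x ^ 2) (by fun_prop)
  simp only [e1]
  rw [h1.integral_eq hT, h2.integral_eq hT, integral_sub (h1.const_mul _).integrable h2.integrable,
    integral_const_mul]

end

/-! ### Paths of small cost -/

/-- The path with densities `u` on `[0,T]` is weakly continuous, has finite energy and dynamical
cost at most `ε`. -/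
structure CheapPath (c : Config → ℝ) (T : ℝ) (u : ℝ → Profile) (ε : ℝ) : Prop where
  meas : Measurable fun p : ℝ × Torus => u p.1 p.2
  weak : ∀ f : Torus → ℝ, Continuous f → ContinuousOn (fun t => ∫ θ, u t θ * f θ) (Icc 0 T)
  energy : ∃ C : ℝ, ∀ G : TestC01 T,
    ∫ p, (2 * (u p.1 p.2 * G.dx p.1 p.2) - G.fn p.1 p.2 ^ 2) ∂(layer T) ≤ C
  cost : ∀ G : TestC12 T,
    (∫ θ, u T θ * G.fn T θ) - (∫ θ, u 0 θ * G.fn 0 θ) - ∫ p, costDensity c u G p ∂(layer T) ≤ ε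

theorem continuousOn_toSubProb {T : ℝ} {u : ℝ → Profile}
    (h : ∀ f : Torus → ℝ, Continuous f → ContinuousOn (fun t => ∫ θ, u t θ * f θ) (Icc 0 T)) :
    ContinuousOn (fun t => (u t).toSubProb) (Icc 0 T) := by
  intro t ht
  unfold ContinuousWithinAt
  rw [tendsto_subtype_rng, FiniteMeasure.tendsto_iff_forall_integral_tendsto]
  intro f
  have := h f f.continuous t ht
  unfold ContinuousWithinAt at this
  simp only [← Profile.integral_meas] at this
  exact this

theorem isCadlag_of_continuousOn {T : ℝ} {π : ℝ → SubProb} (h : ContinuousOn π (Icc 0 T)) :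
    IsCadlag T π := by
  refine ⟨fun t ht => (h t ⟨ht.1, ht.2.le⟩).mono (Icc_subset_Icc_left ht.1), fun t ht =>
    ⟨π t, (h t ⟨ht.1.le, ht.2⟩).mono_left ?_⟩⟩
  refine nhdsWithin_le_iff.2 (mem_of_superset (Ioo_mem_nhdsLT ht.1) fun s hs => ?_)
  exact ⟨hs.1.le, hs.2.le.trans ht.2⟩

theorem CheapPath.quasiPotential_le {c : Config → ℝ} (hc : IsCylinder c) {T : ℝ} (hT : 0 < T)
    {u : ℝ → Profile} {ε : ℝ} (h : CheapPath c T u ε) {M : Set SubProb}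
    (hM : (u 0).toSubProb ∈ M) : quasiPotential c M (u T).toSubProb ≤ (ε : EReal) := by
  unfold quasiPotential
  refine iInf_le_of_le T <| iInf_le_of_le hT <| iInf_le_of_le (u 0) <| iInf_le_of_le hM <|
    iInf_le_of_le (fun t => (u t).toSubProb) <|
    iInf_le_of_le (isCadlag_of_continuousOn (continuousOn_toSubProb h.weak)) <|
    iInf_le_of_le rfl ?_
  obtain ⟨C, hC⟩ := h.energy
  have hE : ReactionDiffusion.energy T (fun t => (u t).toSubProb) < ⊤ := by
    refine lt_of_le_of_lt (iSup_le fun G => ?_) (EReal.coe_lt_top C)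
    rw [energyFunctional_toSubProb hT.le h.meas]
    exact EReal.coe_le_coe_iff.2 (hC G)
  rw [rateFrom, if_pos rfl, rate, if_pos ⟨fun t _ => ⟨u t, rfl⟩, hE⟩]
  refine iSup_le fun G => ?_
  rw [rateFunctional_toSubProb hc hT.le h.meas]
  exact EReal.coe_le_coe_iff.2 (h.cost G)

/-- The zero test function. -/
def TestC12.zero (T : ℝ) : TestC12 T where
  fn := fun _ _ => 0
  dt := fun _ _ => 0
  dx := fun _ _ => 0
  dxx := fun _ _ => 0
  cont_fn := continuousOn_const
  cont_dt := continuousOn_const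
  cont_dx := continuousOn_const
  cont_dxx := continuousOn_const
  hasDeriv_dt := fun _ _ _ => hasDerivWithinAt_const _ _ _
  hasDeriv_dx := fun _ _ _ => hasDerivAt_const _ _
  hasDeriv_dxx := fun _ _ _ => hasDerivAt_const _ _

theorem rate_nonneg (c : Config → ℝ) (T : ℝ) (π : ℝ → SubProb) : 0 ≤ rate c T π := by
  unfold rate
  split_ifs
  · refine le_iSup_of_le (TestC12.zero T) ?_
    simp [rateFunctional, TestC12.zero]
  · exact le_top

theorem quasiPotential_nonneg (c : Config → ℝ) (M : Set SubProb) (ϱ : SubProb) :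
    0 ≤ quasiPotential c M ϱ := by
  unfold quasiPotential
  refine le_iInf fun T => le_iInf fun _ => le_iInf fun γ => le_iInf fun _ => le_iInf fun π =>
    le_iInf fun _ => le_iInf fun _ => ?_
  unfold rateFrom
  split_ifs
  · exact rate_nonneg c T π
  · exact le_top

/-! ### Concatenation of paths -/

/-- Additivity of the time integral, followed by a shift of the second piece. The junction time is
assigned to the first piece only; a single time carries no mass. -/
theorem integral_layer_add {T₁ T₂ : ℝ} (h₁ : 0 ≤ T₁) (h₂ : 0 ≤ T₂) {f f₁ f₂ : ℝ × Torus → ℝ}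
    (hf : BddMeas (T₁ + T₂) f) (hf₁ : BddMeas T₁ f₁) (hf₂ : BddMeas T₂ f₂)
    (e₁ : ∀ t ∈ Icc 0 T₁, ∀ θ, f (t, θ) = f₁ (t, θ))
    (e₂ : ∀ t ∈ Ioc 0 T₂, ∀ θ, f (t + T₁, θ) = f₂ (t, θ)) :
    ∫ p, f p ∂(layer (T₁ + T₂)) = ∫ p, f₁ p ∂(layer T₁) + ∫ p, f₂ p ∂(layer T₂) := by
  have h := add_nonneg h₁ h₂
  rw [← hf.integral_eq h, ← hf₁.integral_eq h₁, ← hf₂.integral_eq h₂]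
  have hi := hf.intervalIntegrable h
  rw [← intervalIntegral.integral_add_adjacent_intervals (b := T₁)
    (hi.mono_set (by rw [uIcc_of_le h₁, uIcc_of_le h]; exact Icc_subset_Icc_right (by linarith)))
    (hi.mono_set (by
      rw [uIcc_of_le (by linarith), uIcc_of_le h]; exact Icc_subset_Icc_left (by linarith)))]
  congr 1
  · refine intervalIntegral.integral_congr fun t ht => ?_
    rw [uIcc_of_le h₁] at ht
    simp only [e₁ t ht]
  · have := intervalIntegral.integral_comp_add_right (a := 0) (b := T₂)
      (fun t => ∫ θ, f (t, θ)) T₁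
    rw [zero_add, add_comm T₂] at this
    rw [← this]
    refine intervalIntegral.integral_congr_ae (ae_of_all _ fun t ht => ?_)
    rw [uIoc_of_le h₂] at ht
    simp only [e₂ t ht]

theorem continuousOn_shift {T₁ T₂ : ℝ} (h₁ : 0 ≤ T₁) {f : ℝ → Torus → ℝ}
    (hf : ContinuousOn (fun p : ℝ × Torus => f p.1 p.2) (Icc 0 (T₁ + T₂) ×ˢ univ)) :
    ContinuousOn (fun p : ℝ × Torus => f (p.1 + T₁) p.2) (Icc 0 T₂ ×ˢ univ) :=
  hf.comp (f := fun p : ℝ × Torus => (p.1 + T₁, p.2)) (by fun_prop)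
    fun p hp => ⟨⟨by linarith [hp.1.1], by linarith [hp.1.2]⟩, mem_univ _⟩

/-- Restriction of a test function to a shorter time interval. -/
def TestC12.restrict {T S : ℝ} (G : TestC12 T) (h : S ≤ T) : TestC12 S where
  fn := G.fn
  dt := G.dt
  dx := G.dx
  dxx := G.dxx
  cont_fn := G.cont_fn.mono (prod_mono (Icc_subset_Icc_right h) subset_rfl)
  cont_dt := G.cont_dt.mono (prod_mono (Icc_subset_Icc_right h) subset_rfl)
  cont_dx := G.cont_dx.mono (prod_mono (Icc_subset_Icc_right h) subset_rfl)
  cont_dxx := G.cont_dxx.mono (prod_mono (Icc_subset_Icc_right h) subset_rfl)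
  hasDeriv_dt := fun t ht θ =>
    (G.hasDeriv_dt t (Icc_subset_Icc_right h ht) θ).mono (Icc_subset_Icc_right h)
  hasDeriv_dx := fun t ht => G.hasDeriv_dx t (Icc_subset_Icc_right h ht)
  hasDeriv_dxx := fun t ht => G.hasDeriv_dxx t (Icc_subset_Icc_right h ht)

/-- The part of a test function after time `T₁`. -/
def TestC12.shift {T₁ T₂ : ℝ} (G : TestC12 (T₁ + T₂)) (h : 0 ≤ T₁) : TestC12 T₂ where
  fn := fun t => G.fn (t + T₁)
  dt := fun t => G.dt (t + T₁)
  dx := fun t => G.dx (t + T₁)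
  dxx := fun t => G.dxx (t + T₁)
  cont_fn := continuousOn_shift h G.cont_fn
  cont_dt := continuousOn_shift h G.cont_dt
  cont_dx := continuousOn_shift h G.cont_dx
  cont_dxx := continuousOn_shift h G.cont_dxx
  hasDeriv_dt := fun t ht θ => by
    have hd := G.hasDeriv_dt (t + T₁) ⟨by linarith [ht.1], by linarith [ht.2]⟩ θ
    have hs : HasDerivWithinAt (fun s => s + T₁) 1 (Icc 0 T₂) t :=
      (hasDerivWithinAt_id t _).add_const T₁
    have hm : MapsTo (fun s => s + T₁) (Icc 0 T₂) (Icc 0 (T₁ + T₂)) :=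
      fun s hs => ⟨by linarith [hs.1], by linarith [hs.2]⟩
    have := HasDerivWithinAt.comp (h₂ := fun s => G.fn s θ) t hd hs hm
    rwa [mul_one] at this
  hasDeriv_dx := fun t ht => G.hasDeriv_dx _ ⟨by linarith [ht.1], by linarith [ht.2]⟩
  hasDeriv_dxx := fun t ht => G.hasDeriv_dxx _ ⟨by linarith [ht.1], by linarith [ht.2]⟩

/-- Restriction of a test function to a shorter time interval. -/
def TestC01.restrict {T S : ℝ} (G : TestC01 T) (h : S ≤ T) : TestC01 S where
  fn := G.fn
  dx := G.dx
  cont_fn := G.cont_fn.mono (prod_mono (Icc_subset_Icc_right h) subset_rfl)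
  cont_dx := G.cont_dx.mono (prod_mono (Icc_subset_Icc_right h) subset_rfl)
  hasDeriv_dx := fun t ht => G.hasDeriv_dx t (Icc_subset_Icc_right h ht)

/-- The part of a test function after time `T₁`. -/
def TestC01.shift {T₁ T₂ : ℝ} (G : TestC01 (T₁ + T₂)) (h : 0 ≤ T₁) : TestC01 T₂ where
  fn := fun t => G.fn (t + T₁)
  dx := fun t => G.dx (t + T₁)
  cont_fn := continuousOn_shift h G.cont_fn
  cont_dx := continuousOn_shift h G.cont_dx
  hasDeriv_dx := fun t ht => G.hasDeriv_dx _ ⟨by linarith [ht.1], by linarith [ht.2]⟩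

/-- The path following `u₁` up to time `T₁` and `u₂` afterwards. -/
noncomputable def concat (T₁ : ℝ) (u₁ u₂ : ℝ → Profile) (t : ℝ) : Profile :=
  if t ≤ T₁ then u₁ t else u₂ (t - T₁)

section
variable {c : Config → ℝ} {T₁ T₂ : ℝ} {u₁ u₂ : ℝ → Profile}

theorem concat_left {t : ℝ} (h : t ≤ T₁) : concat T₁ u₁ u₂ t = u₁ t := if_pos h

theorem concat_right (he : u₁ T₁ = u₂ 0) {t : ℝ} (h : 0 ≤ t) :
    concat T₁ u₁ u₂ (t + T₁) = u₂ t := by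
  rcases h.eq_or_lt with rfl | h
  · rw [zero_add, concat_left le_rfl, he]
  · rw [concat, if_neg (by linarith), add_sub_cancel_right]

theorem measurable_concat (h₁ : Measurable fun p : ℝ × Torus => u₁ p.1 p.2)
    (h₂ : Measurable fun p : ℝ × Torus => u₂ p.1 p.2) :
    Measurable fun p : ℝ × Torus => concat T₁ u₁ u₂ p.1 p.2 := by
  have : (fun p : ℝ × Torus => concat T₁ u₁ u₂ p.1 p.2) =
      fun p => if p.1 ≤ T₁ then u₁ p.1 p.2 else u₂ (p.1 - T₁) p.2 := by
    funext p
    unfold concat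
    split_ifs <;> rfl
  rw [this]
  exact Measurable.ite (measurableSet_le measurable_fst measurable_const) h₁
    (h₂.comp ((measurable_fst.sub_const T₁).prodMk measurable_snd))

theorem integral_layer_costDensity_concat (hc : IsCylinder c) (h₁ : 0 ≤ T₁) (h₂ : 0 ≤ T₂)
    (hm₁ : Measurable fun p : ℝ × Torus => u₁ p.1 p.2)
    (hm₂ : Measurable fun p : ℝ × Torus => u₂ p.1 p.2) (he : u₁ T₁ = u₂ 0)
    (G : TestC12 (T₁ + T₂)) :
    ∫ p, costDensity c (concat T₁ u₁ u₂) G p ∂(layer (T₁ + T₂)) =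
      ∫ p, costDensity c u₁ (G.restrict (le_add_of_nonneg_right h₂)) p ∂(layer T₁) +
      ∫ p, costDensity c u₂ (G.shift h₁) p ∂(layer T₂) := by
  refine integral_layer_add h₁ h₂ (bddMeas_costDensity hc (measurable_concat hm₁ hm₂) G)
    (bddMeas_costDensity hc hm₁ _) (bddMeas_costDensity hc hm₂ _) (fun t ht θ => ?_)
    fun t ht θ => ?_
  · simp only [costDensity, concat_left ht.2, TestC12.restrict]
  · simp only [costDensity, concat_right he ht.1.le, TestC12.shift]

theorem bddMeas_energyDensity {T : ℝ} {u : ℝ → Profile}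
    (hu : Measurable fun p : ℝ × Torus => u p.1 p.2) (G : TestC01 T) :
    BddMeas T fun p => 2 * (u p.1 p.2 * G.dx p.1 p.2) - G.fn p.1 p.2 ^ 2 :=
  (((bddMeas_profile hu T).mul G.bddMeas_dx).const_mul _).sub
    (G.bddMeas_fn.comp (Φ := fun x => x ^ 2) (by fun_prop))

/-- A test function on the long interval restricts to one on each piece. The boundary terms at the
junction cancel because the profiles agree there, so the two bounds add up. -/
theorem CheapPath.concat (hc : IsCylinder c) (h₁ : 0 ≤ T₁) (h₂ : 0 ≤ T₂) {ε₁ ε₂ : ℝ}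
    (hp₁ : CheapPath c T₁ u₁ ε₁) (hp₂ : CheapPath c T₂ u₂ ε₂) (he : u₁ T₁ = u₂ 0) :
    CheapPath c (T₁ + T₂) (concat T₁ u₁ u₂) (ε₁ + ε₂) where
  meas := measurable_concat hp₁.meas hp₂.meas
  weak := fun f hf => by
    have hU : Icc 0 (T₁ + T₂) = Icc 0 T₁ ∪ Icc T₁ (T₁ + T₂) :=
      (Icc_union_Icc_eq_Icc h₁ (by linarith)).symm
    rw [hU]
    refine ContinuousOn.union_of_isClosed ?_ ?_ isClosed_Icc isClosed_Icc
    · exact (hp₁.weak f hf).congr fun t ht => by simp only [concat_left ht.2]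
    · have := (hp₂.weak f hf).comp (f := fun t => t - T₁) (s := Icc T₁ (T₁ + T₂)) (by fun_prop)
        fun t ht => ⟨by linarith [ht.1], by linarith [ht.2]⟩
      refine this.congr fun t ht => ?_
      have e := concat_right he (sub_nonneg.2 ht.1)
      rw [sub_add_cancel] at e
      simp only [e, Function.comp]
  energy := by
    obtain ⟨C₁, hC₁⟩ := hp₁.energy
    obtain ⟨C₂, hC₂⟩ := hp₂.energy
    refine ⟨C₁ + C₂, fun G => ?_⟩
    rw [integral_layer_add h₁ h₂
      (bddMeas_energyDensity (measurable_concat hp₁.meas hp₂.meas) G)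
      (bddMeas_energyDensity hp₁.meas (G.restrict (le_add_of_nonneg_right h₂)))
      (bddMeas_energyDensity hp₂.meas (G.shift h₁))
      (fun t ht θ => by simp only [concat_left ht.2, TestC01.restrict])
      (fun t ht θ => by simp only [concat_right he ht.1.le, TestC01.shift])]
    exact add_le_add (hC₁ _) (hC₂ _)
  cost := fun G => by
    rw [integral_layer_costDensity_concat hc h₁ h₂ hp₁.meas hp₂.meas he]
    have c₁ := hp₁.cost (G.restrict (le_add_of_nonneg_right h₂))
    have c₂ := hp₂.cost (G.shift h₁)
    simp only [TestC12.restrict, TestC12.shift, zero_add] at c₁ c₂ ⊢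
    have e : ReactionDiffusion.concat T₁ u₁ u₂ (T₁ + T₂) = u₂ T₂ := by
      rw [add_comm]; exact concat_right he h₂
    rw [e, concat_left h₁]
    rw [add_comm T₂ T₁, ← he] at c₂
    linarith

end

/-! ### Linear interpolation between profiles -/

/-- The path going linearly from `A` to `B` in the time interval `[0,1]`. -/
noncomputable def interp (A B : Profile) (t : ℝ) : Profile where
  toFun := fun θ => (1 - (projIcc (0 : ℝ) 1 zero_le_one t : ℝ)) * A θ
    + (projIcc (0 : ℝ) 1 zero_le_one t : ℝ) * B θ
  measurable_toFun := (A.measurable_toFun.const_mul _).add (B.measurable_toFun.const_mul _)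
  mem_Icc := fun θ => (convex_Icc (0 : ℝ) 1) (A.mem_Icc θ) (B.mem_Icc θ)
    (sub_nonneg.2 (projIcc (0 : ℝ) 1 zero_le_one t).2.2) (projIcc (0 : ℝ) 1 zero_le_one t).2.1
    (by ring)

theorem interp_apply (A B : Profile) {t : ℝ} (ht : t ∈ Icc (0 : ℝ) 1) (θ : Torus) :
    interp A B t θ = (1 - t) * A θ + t * B θ := by
  change (1 - (projIcc (0 : ℝ) 1 zero_le_one t : ℝ)) * A θ
    + (projIcc (0 : ℝ) 1 zero_le_one t : ℝ) * B θ = _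
  rw [projIcc_of_mem _ ht]

theorem Profile.ext {A B : Profile} (h : ∀ θ, A θ = B θ) : A = B := by
  cases A; cases B
  congr 1
  exact funext h

theorem interp_zero (A B : Profile) : interp A B 0 = A :=
  Profile.ext fun θ => by rw [interp_apply A B (by simp)]; ring

theorem interp_one (A B : Profile) : interp A B 1 = B :=
  Profile.ext fun θ => by rw [interp_apply A B (by simp)]; ring

theorem measurable_interp (A B : Profile) :
    Measurable fun p : ℝ × Torus => interp A B p.1 p.2 := by
  have hp : Measurable fun p : ℝ × Torus => (projIcc (0 : ℝ) 1 zero_le_one p.1 : ℝ) :=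
    (continuous_subtype_val.comp (continuous_projIcc.comp continuous_fst)).measurable
  exact ((measurable_const.sub hp).mul (A.measurable_toFun.comp measurable_snd)).add
    (hp.mul (B.measurable_toFun.comp measurable_snd))

theorem continuousOn_integral_interp (A B : Profile) {f : Torus → ℝ} (hf : Continuous f) :
    ContinuousOn (fun t => ∫ θ, interp A B t θ * f θ) (Icc 0 1) := by
  have hA := A.integrable_mul (integrable_of_continuous hf)
  have hB := B.integrable_mul (integrable_of_continuous hf)
  have : ContinuousOn (fun t : ℝ => (1 - t) * (∫ θ, A θ * f θ) + t * ∫ θ, B θ * f θ)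
      (Icc 0 1) := by fun_prop
  refine this.congr fun t ht => ?_
  dsimp only
  rw [← integral_const_mul, ← integral_const_mul,
    ← integral_add (hA.const_mul _) (hB.const_mul _)]
  refine integral_congr_ae (ae_of_all _ fun θ => ?_)
  simp only [interp_apply A B ht]
  ring

/-- A path of continuously differentiable profiles with bounded derivatives has finite energy. -/
theorem integral_energyDensity_le {T : ℝ} (hT : 0 ≤ T) {u : ℝ → Profile}
    (hu : Measurable fun p : ℝ × Torus => u p.1 p.2) {u' : ℝ → Torus → ℝ} {K : ℝ}
    (hd : ∀ t ∈ Icc 0 T, HasDx (u t) (u' t)) (hK : ∀ t ∈ Icc 0 T, ∀ θ, |u' t θ| ≤ K)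
    (G : TestC01 T) :
    ∫ p, (2 * (u p.1 p.2 * G.dx p.1 p.2) - G.fn p.1 p.2 ^ 2) ∂(layer T) ≤ T * K ^ 2 := by
  have hb := bddMeas_energyDensity hu G
  rw [← hb.integral_eq hT]
  have : T * K ^ 2 = ∫ _ in 0..T, K ^ 2 := by simp
  rw [this]
  refine intervalIntegral.integral_mono_on hT (hb.intervalIntegrable hT) (by simp) fun t ht => ?_
  have hG : HasDx (G.fn t) (G.dx t) := ⟨continuous_section G.cont_dx ht, G.hasDeriv_dx t ht⟩
  have hut := (hd t ht).continuous
  have hGc := hG.continuous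
  have hu' := (hd t ht).cont
  have hGd := hG.cont
  -- After integration by parts the pairing is `-2 ∫ u' G - ∫ G²`, and completing the square bounds
  -- it by `∫ (u')²`.
  dsimp only
  rw [integral_sub (integrable_of_continuous (by fun_prop)) (integrable_of_continuous (by fun_prop)),
    integral_const_mul, (hd t ht).integral_mul hG, ← sub_nonneg]
  have e : K ^ 2 = ∫ _ : Torus, K ^ 2 := by simp [measureReal_def]
  rw [e, mul_neg, ← integral_const_mul, ← integral_neg,
    ← integral_sub (integrable_of_continuous (by fun_prop)) (integrable_of_continuous (by fun_prop)),
    ← integral_sub (integrable_of_continuous (by fun_prop)) (integrable_of_continuous (by fun_prop))]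
  refine integral_nonneg fun θ => ?_
  have h1 := sq_le_sq' (abs_le.1 (hK t ht θ)).1 (abs_le.1 (hK t ht θ)).2
  have h2 := sq_nonneg (u' t θ + G.fn t θ)
  simp only [Pi.zero_apply]
  nlinarith

/-- The right-hand side equals `4 sinh² (g / 2)`, and `|sinh x| ≥ |x|`. -/
theorem sq_le_exp_add_exp_neg (g : ℝ) : g ^ 2 ≤ Real.exp g + Real.exp (-g) - 2 := by
  have h1 : (g / 2) ^ 2 ≤ Real.sinh (g / 2) ^ 2 := by
    rcases le_total 0 (g / 2) with h | h
    · exact pow_le_pow_left₀ h (Real.self_le_sinh_iff.2 h) 2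
    · have := Real.sinh_le_self_iff.2 h
      nlinarith
  have h2 := Real.cosh_two_mul (g / 2)
  have h3 := Real.cosh_sq (g / 2)
  have h4 := Real.cosh_eq g
  rw [show 2 * (g / 2) = g by ring] at h2
  nlinarith

/-- Legendre-type bound of the pointwise cost. -/
theorem pointwise_cost_le {a b β B D F g h d k w χ χ₀ : ℝ} (hb : 0 < b) (hχ₀ : 0 < χ₀)
    (hB : b ≤ B) (hD : b ≤ D) (hχ : χ₀ ≤ χ) (hw : |w| ≤ 1) (hk : |k| ≤ β)
    (ha : |h + F - (B - D)| ≤ a) :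
    h * g + F * g + 1 / 2 * (w * k * d) - 1 / 2 * (χ * d ^ 2)
      - (B * (Real.exp g - 1) + D * (Real.exp (-g) - 1)) ≤ a ^ 2 / (4 * b) + β ^ 2 / (8 * χ₀) := by
  have e1 := Real.add_one_le_exp g
  have e2 := Real.add_one_le_exp (-g)
  have e3 := sq_le_exp_add_exp_neg g
  -- Both brackets are nonnegative, so `B` and `D` may be lowered to `b`; this gives the quadratic
  -- growth in `g`.
  have s1 : b * g ^ 2 ≤ B * (Real.exp g - 1 - g) + D * (Real.exp (-g) - 1 + g) := by
    have := mul_le_mul_of_nonneg_right hB (show 0 ≤ Real.exp g - 1 - g by linarith)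
    have := mul_le_mul_of_nonneg_right hD (show 0 ≤ Real.exp (-g) - 1 + g by linarith)
    nlinarith
  have hwk : (w * k) ^ 2 ≤ β ^ 2 := by
    refine sq_le_sq' ?_ ?_
    all_goals
      have : |w * k| ≤ β := by
        rw [abs_mul]; nlinarith [abs_nonneg k, abs_nonneg w]
      have := abs_le.1 this
      linarith
  -- Maximising over `d` gives `(w k)² / (8 χ₀)`, by completing the square.
  have s2 : 1 / 2 * (w * k * d) - 1 / 2 * (χ * d ^ 2) ≤ β ^ 2 / (8 * χ₀) := by
    rw [le_div_iff₀ (by positivity)]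
    have : χ₀ * d ^ 2 ≤ χ * d ^ 2 := mul_le_mul_of_nonneg_right hχ (sq_nonneg d)
    nlinarith [sq_nonneg (w * k - 2 * χ₀ * d)]
  have hasq : (h + F - (B - D)) ^ 2 ≤ a ^ 2 := sq_le_sq' (abs_le.1 ha).1 (abs_le.1 ha).2
  -- Maximising over `g` gives the square of the linear coefficient divided by `4 b`.
  have s3 : (h + F - (B - D)) * g - b * g ^ 2 ≤ a ^ 2 / (4 * b) := by
    rw [le_div_iff₀ (by positivity)]
    nlinarith [sq_nonneg (h + F - (B - D) - 2 * b * g)]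
  linarith

section
variable {c : Config → ℝ} {A B φ : Profile} {A' B' φ' φ'' : Torus → ℝ}

theorem HasDx.interp (hA : HasDx A A') (hB : HasDx B B') {t : ℝ} (ht : t ∈ Icc (0 : ℝ) 1) :
    HasDx (interp A B t) (fun θ => (1 - t) * A' θ + t * B' θ) := by
  have := (hA.const_mul (1 - t)).add (hB.const_mul t)
  rwa [← funext (interp_apply A B ht)] at this

/-- For each fixed `θ` this is the fundamental theorem of calculus in time, applied to the product
of the interpolation and `G`; Fubini does the rest. The time derivative of the interpolation is `B -
A`. -/
theorem integral_interp_boundary (hA : Continuous A) (hB : Continuous B) (G : TestC12 1) :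
    (∫ θ, B θ * G.fn 1 θ) - (∫ θ, A θ * G.fn 0 θ) =
      ∫ p, ((B p.2 - A p.2) * G.fn p.1 p.2 + interp A B p.1 p.2 * G.dt p.1 p.2) ∂(layer 1) := by
  have hb : BddMeas 1 fun p : ℝ × Torus => (B p.2 - A p.2) * G.fn p.1 p.2
      + interp A B p.1 p.2 * G.dt p.1 p.2 :=
    ((BddMeas.of_continuousOn (by fun_prop)).mul G.bddMeas_fn).add
      ((bddMeas_profile (measurable_interp A B) 1).mul G.bddMeas_dt)
  rw [← hb.integral_swap zero_le_one, ← integral_sub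
    (B.integrable_mul (integrable_of_continuous (continuous_section G.cont_fn (by simp))))
    (A.integrable_mul (integrable_of_continuous (continuous_section G.cont_fn (by simp))))]
  refine integral_congr_ae (ae_of_all _ fun θ => ?_)
  have hm : MapsTo (fun t : ℝ => (t, θ)) (Icc 0 1) (Icc 0 1 ×ˢ univ) := fun t ht => ⟨ht, mem_univ _⟩
  have c1 : ContinuousOn (fun t => G.fn t θ) (Icc 0 1) :=
    G.cont_fn.comp (f := fun t : ℝ => (t, θ)) (by fun_prop) hm
  have c2 : ContinuousOn (fun t => G.dt t θ) (Icc 0 1) :=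
    G.cont_dt.comp (f := fun t : ℝ => (t, θ)) (by fun_prop) hm
  have key := intervalIntegral.integral_eq_sub_of_hasDerivAt_of_le (a := 0) (b := 1)
    (f := fun t => ((1 - t) * A θ + t * B θ) * G.fn t θ)
    (f' := fun t => (B θ - A θ) * G.fn t θ + ((1 - t) * A θ + t * B θ) * G.dt t θ)
    zero_le_one (by fun_prop) (fun t ht => by
      have h1 := (G.hasDeriv_dt t (Ioo_subset_Icc_self ht) θ).hasDerivAt (Icc_mem_nhds ht.1 ht.2)
      have h2 : HasDerivAt (fun t : ℝ => (1 - t) * A θ + t * B θ) (B θ - A θ) t := by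
        have := (((hasDerivAt_id t).const_sub 1).mul_const (A θ)).add
          ((hasDerivAt_id t).mul_const (B θ))
        convert! this using 1
        ring
      exact h2.mul h1)
    (ContinuousOn.intervalIntegrable (by rw [uIcc_of_le zero_le_one]; fun_prop))
  have e : ∫ t in (0 : ℝ)..1, ((B θ - A θ) * G.fn t θ + interp A B t θ * G.dt t θ) =
      ∫ t in (0 : ℝ)..1, ((B θ - A θ) * G.fn t θ + ((1 - t) * A θ + t * B θ) * G.dt t θ) := by
    refine intervalIntegral.integral_congr fun t ht => ?_
    rw [uIcc_of_le zero_le_one] at ht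
    simp only [interp_apply A B ht]
  simp only
  rw [e, key]
  ring

/-- Integration by parts in space, on a layer. -/
theorem integral_layer_mul_dxx {T : ℝ} (hT : 0 ≤ T) {u u' : ℝ → Torus → ℝ}
    (hu : BddMeas T fun p => u p.1 p.2) (hu' : BddMeas T fun p => u' p.1 p.2)
    (hd : ∀ t ∈ Icc 0 T, HasDx (u t) (u' t)) (G : TestC12 T) :
    ∫ p, u p.1 p.2 * G.dxx p.1 p.2 ∂(layer T) = -∫ p, u' p.1 p.2 * G.dx p.1 p.2 ∂(layer T) := by
  rw [← (hu.mul G.bddMeas_dxx).integral_eq hT, ← (hu'.mul G.bddMeas_dx).integral_eq hT,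
    ← intervalIntegral.integral_neg]
  refine intervalIntegral.integral_congr fun t ht => ?_
  rw [uIcc_of_le hT] at ht
  exact (hd t ht).integral_mul ⟨continuous_section G.cont_dxx ht, G.hasDeriv_dxx t ht⟩

theorem integral_layer_mul_dx {T : ℝ} (hT : 0 ≤ T) {u u' : ℝ → Torus → ℝ}
    (hu : BddMeas T fun p => u p.1 p.2) (hu' : BddMeas T fun p => u' p.1 p.2)
    (hd : ∀ t ∈ Icc 0 T, HasDx (u t) (u' t)) (G : TestC12 T) :
    ∫ p, u p.1 p.2 * G.dx p.1 p.2 ∂(layer T) = -∫ p, u' p.1 p.2 * G.fn p.1 p.2 ∂(layer T) := by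
  rw [← (hu.mul G.bddMeas_dx).integral_eq hT, ← (hu'.mul G.bddMeas_fn).integral_eq hT,
    ← intervalIntegral.integral_neg]
  refine intervalIntegral.integral_congr fun t ht => ?_
  rw [uIcc_of_le hT] at ht
  exact (hd t ht).integral_mul ⟨continuous_section G.cont_dx ht, G.hasDeriv_dx t ht⟩

/-- The linear interpolation between two profiles which are `C¹`-close to a common stationary
solution is cheap. -/
theorem cheapPath_interp (hc : IsCylinder c) (hA : HasDx A A') (hB : HasDx B B')
    (hφ : HasDx φ φ') (hφ' : HasDx φ' φ'') (heq : ∀ θ, φ'' θ = -2 * reaction c (φ θ))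
    {t₀ : ℝ} (ht₀ : t₀ ∈ Icc (0 : ℝ) 1) (hφAB : ∀ θ, φ θ = (1 - t₀) * A θ + t₀ * B θ)
    {b χ₀ α β : ℝ} (hb : 0 < b) (hχ₀ : 0 < χ₀)
    (hbd : ∀ t ∈ Icc (0 : ℝ) 1, ∀ θ, b ≤ birth c (interp A B t θ) ∧ b ≤ death c (interp A B t θ) ∧
      χ₀ ≤ mobility (interp A B t θ))
    (hα : ∀ t ∈ Icc (0 : ℝ) 1, ∀ θ,
      |B θ - A θ + reaction c (φ θ) - reaction c (interp A B t θ)| ≤ α)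
    (hβ : ∀ θ, |B' θ - A' θ| ≤ β) :
    CheapPath c 1 (interp A B) (α ^ 2 / (4 * b) + β ^ 2 / (8 * χ₀)) where
  meas := measurable_interp A B
  weak := fun f hf => continuousOn_integral_interp A B hf
  energy := by
    obtain ⟨K, hK⟩ := isCompact_univ.exists_bound_of_continuousOn hA.cont.continuousOn
    obtain ⟨L, hL⟩ := isCompact_univ.exists_bound_of_continuousOn hB.cont.continuousOn
    refine ⟨1 * max K L ^ 2, fun G => integral_energyDensity_le zero_le_one
      (measurable_interp A B) (fun t ht => hA.interp hB ht) (fun t ht θ => ?_) G⟩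
    have h1 := abs_le.1 ((hK θ (mem_univ _)).trans (le_max_left K L))
    have h2 := abs_le.1 ((hL θ (mem_univ _)).trans (le_max_right K L))
    exact abs_le.2 (convex_Icc _ _ h1 h2 (sub_nonneg.2 ht.2) ht.1 (by ring))
  cost := fun G => by
    -- Since `φ` is the point at time `t₀` of the segment from `A` to `B`, the gradient of the path
    -- minus `φ'` is `(t - t₀) (B' - A')`.
    have hφAB' : ∀ θ, φ' θ = (1 - t₀) * A' θ + t₀ * B' θ := fun θ => by
      induction θ using QuotientAddGroup.induction_on with | _ x =>
      have h1 := ((hA.const_mul (1 - t₀)).add (hB.const_mul t₀)).deriv x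
      rw [← funext hφAB] at h1
      exact (hφ.deriv x).unique h1
    have mu : BddMeas 1 fun p : ℝ × Torus => interp A B p.1 p.2 :=
      bddMeas_profile (measurable_interp A B) 1
    have cA' := hA.cont
    have cB' := hB.cont
    have cA := hA.continuous
    have cB := hB.continuous
    have cφ' := hφ.cont
    have cφ := hφ.continuous
    have mu' : BddMeas 1 fun p : ℝ × Torus => (1 - p.1) * A' p.2 + p.1 * B' p.2 :=
      .of_continuousOn (by fun_prop)
    have mφ' : BddMeas 1 fun p : ℝ × Torus => φ' p.2 := .of_continuousOn (by fun_prop)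
    have mφ'' : BddMeas 1 fun p : ℝ × Torus => φ'' p.2 :=
      .of_continuousOn (hφ'.cont.comp continuous_snd).continuousOn
    have mh : BddMeas 1 fun p : ℝ × Torus => B p.2 - A p.2 := .of_continuousOn (by fun_prop)
    have i1 := integral_layer_mul_dxx zero_le_one mu mu' (fun t ht => hA.interp hB ht) G
    have i2 := integral_layer_mul_dx (u := fun _ => φ') zero_le_one mφ' mφ'' (fun _ _ => hφ') G
    have m1 : BddMeas 1 fun p : ℝ × Torus => (B p.2 - A p.2) * G.fn p.1 p.2
        + interp A B p.1 p.2 * G.dt p.1 p.2 :=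
      (mh.mul G.bddMeas_fn).add (mu.mul G.bddMeas_dt)
    have m2 := mu.mul G.bddMeas_dxx
    have m3 := mu'.mul G.bddMeas_dx
    have m4 := mφ'.mul G.bddMeas_dx
    have m5 := mφ''.mul G.bddMeas_fn
    have mK := bddMeas_costDensity hc (measurable_interp A B) G
    rw [interp_zero, interp_one, integral_interp_boundary cA cB G, ← integral_sub m1.integrable
      mK.integrable]
    -- The four added terms have total integral zero, by integration by parts for the path (`i1`)
    -- and for `φ` (`i2`). They replace the Laplacian term by a gradient term relative to `φ'`, and
    -- the term with `φ''` becomes `F(φ) G` by the stationary equation. The new integrand has the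
    -- form bounded by `pointwise_cost_le`.
    have e : ∫ p, ((B p.2 - A p.2) * G.fn p.1 p.2 + interp A B p.1 p.2 * G.dt p.1 p.2
          - costDensity c (interp A B) G p) ∂(layer 1) =
        ∫ p, ((B p.2 - A p.2) * G.fn p.1 p.2 + interp A B p.1 p.2 * G.dt p.1 p.2
          - costDensity c (interp A B) G p
          + 1 / 2 * (interp A B p.1 p.2 * G.dxx p.1 p.2)
          + 1 / 2 * (((1 - p.1) * A' p.2 + p.1 * B' p.2) * G.dx p.1 p.2)
          - 1 / 2 * (φ' p.2 * G.dx p.1 p.2) - 1 / 2 * (φ'' p.2 * G.fn p.1 p.2)) ∂(layer 1) := by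
      rw [integral_sub ((((m1.sub mK).add (m2.const_mul _)).add (m3.const_mul _)).sub
          (m4.const_mul _)).integrable (m5.const_mul _).integrable,
        integral_sub (((m1.sub mK).add (m2.const_mul _)).add (m3.const_mul _)).integrable
          (m4.const_mul _).integrable,
        integral_add ((m1.sub mK).add (m2.const_mul _)).integrable (m3.const_mul _).integrable,
        integral_add (m1.sub mK).integrable (m2.const_mul _).integrable,
        integral_const_mul, integral_const_mul, integral_const_mul, integral_const_mul, i1, i2]
      ring
    rw [e]
    have mall := (((((m1.sub mK).add (m2.const_mul (1 / 2))).add (m3.const_mul (1 / 2))).sub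
          (m4.const_mul (1 / 2))).sub (m5.const_mul (1 / 2)))
    refine (mall.integral_mono (g := fun _ => α ^ 2 / (4 * b) + β ^ 2 / (8 * χ₀))
      (.of_continuousOn continuousOn_const) fun p hp => ?_).trans ?_
    · obtain ⟨hb1, hb2, hb3⟩ := hbd p.1 hp.1 p.2
      have hw : |p.1 - t₀| ≤ 1 := by
        rw [abs_le]; constructor <;> linarith [hp.1.1, hp.1.2, ht₀.1, ht₀.2]
      have ha := hα p.1 hp.1 p.2
      have := pointwise_cost_le (g := G.fn p.1 p.2) (d := G.dx p.1 p.2) hb hχ₀ hb1 hb2 hb3 hw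
        (hβ p.2) ha
      refine le_trans (le_of_eq ?_) this
      simp only [costDensity, hφAB', heq]
      ring
    · simp [layer_real_univ]

end

/-! ### Fourier modes -/

/-- `θ ↦ cos (2πkθ)`. -/
noncomputable def cosMode (k : ℤ) (θ : Torus) : ℝ := (fourier k θ : ℂ).re

/-- `θ ↦ sin (2πkθ)`. -/
noncomputable def sinMode (k : ℤ) (θ : Torus) : ℝ := (fourier k θ : ℂ).im

/-- The frequency `2πk`. -/
noncomputable def freq (k : ℤ) : ℝ := 2 * Real.pi * k

theorem continuous_cosMode (k : ℤ) : Continuous (cosMode k) :=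
  Complex.continuous_re.comp (fourier k).continuous

theorem continuous_sinMode (k : ℤ) : Continuous (sinMode k) :=
  Complex.continuous_im.comp (fourier k).continuous

theorem fourier_coe_eq_exp (k : ℤ) (x : ℝ) :
    (fourier k (x : Torus) : ℂ) = Complex.exp ((freq k * x : ℝ) * Complex.I) := by
  rw [fourier_coe_apply, freq]
  push_cast
  congr 1
  ring

theorem lift_cosMode (k : ℤ) : lift (cosMode k) = fun x => Real.cos (freq k * x) := by
  funext x
  rw [lift, cosMode, fourier_coe_eq_exp, Complex.exp_ofReal_mul_I_re]

theorem lift_sinMode (k : ℤ) : lift (sinMode k) = fun x => Real.sin (freq k * x) := by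
  funext x
  rw [lift, sinMode, fourier_coe_eq_exp, Complex.exp_ofReal_mul_I_im]

theorem hasDx_cosMode (k : ℤ) : HasDx (cosMode k) (fun θ => -freq k * sinMode k θ) := by
  refine ⟨(continuous_sinMode k).const_mul _, fun x => ?_⟩
  have h := ((hasDerivAt_id x).const_mul (freq k)).cos
  have e : lift (fun θ => -freq k * sinMode k θ) x = -freq k * lift (sinMode k) x := rfl
  rw [e, lift_cosMode, lift_sinMode]
  convert! h using 1
  simp; ring

theorem hasDx_sinMode (k : ℤ) : HasDx (sinMode k) (fun θ => freq k * cosMode k θ) := by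
  refine ⟨(continuous_cosMode k).const_mul _, fun x => ?_⟩
  have h := ((hasDerivAt_id x).const_mul (freq k)).sin
  have e : lift (fun θ => freq k * cosMode k θ) x = freq k * lift (cosMode k) x := rfl
  rw [e, lift_cosMode, lift_sinMode]
  convert! h using 1
  simp; ring

theorem integrable_mul_of_continuous {f g : Torus → ℝ} (hf : Integrable f) (hg : Continuous g) :
    Integrable fun θ => f θ * g θ := by
  obtain ⟨C, hC⟩ := isCompact_univ.exists_bound_of_continuousOn hg.continuousOn
  exact hf.mul_bdd (c := C) hg.aestronglyMeasurable (ae_of_all _ fun θ => hC θ (mem_univ _))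

theorem volume_eq_haarAddCircle : (volume : Measure Torus) = AddCircle.haarAddCircle := by
  rw [AddCircle.volume_eq_smul_haarAddCircle]; simp

theorem integrable_of_memLp_two {f : Torus → ℝ} (hf : MemLp f 2) : Integrable f :=
  hf.integrable (by norm_num)

/-- Parseval's identity in real form. -/
theorem hasSum_sq_modes {f : Torus → ℝ} (hf : MemLp f 2) :
    HasSum (fun k : ℤ => (∫ θ, f θ * cosMode k θ) ^ 2 + (∫ θ, f θ * sinMode k θ) ^ 2)
      (∫ θ, f θ ^ 2) := by
  have hF : MemLp (fun θ => (f θ : ℂ)) 2 (AddCircle.haarAddCircle (T := 1)) := by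
    rw [← volume_eq_haarAddCircle]; exact hf.ofReal
  have key := hasSum_sq_fourierCoeff hF.toLp
  have hae := hF.coeFn_toLp
  have e1 : ∫ t, ‖(hF.toLp : Torus → ℂ) t‖ ^ 2 ∂AddCircle.haarAddCircle = ∫ θ, f θ ^ 2 := by
    rw [volume_eq_haarAddCircle]
    refine integral_congr_ae ?_
    filter_upwards [hae] with θ hθ
    rw [hθ]; simp
  rw [e1] at key
  convert! key using 2 with k
  rw [fourierCoeff_congr_ae hae]
  have hi := integrable_of_memLp_two hf
  have e2 : fourierCoeff (fun θ : Torus => (f θ : ℂ)) k =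
      ((∫ θ, f θ * cosMode k θ : ℝ) : ℂ) - ((∫ θ, f θ * sinMode k θ : ℝ) : ℂ) * Complex.I := by
    rw [fourierCoeff, ← volume_eq_haarAddCircle, ← integral_complex_ofReal, ← integral_complex_ofReal,
      ← integral_mul_const, ← integral_sub
        (integrable_mul_of_continuous hi (continuous_cosMode k)).ofReal
        ((integrable_mul_of_continuous hi (continuous_sinMode k)).ofReal.mul_const _)]
    refine integral_congr_ae (ae_of_all _ fun θ => ?_)
    simp only [fourier_neg, smul_eq_mul, cosMode, sinMode]
    apply Complex.ext <;> simp <;> ring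
  rw [e2, Complex.sq_norm, Complex.normSq_apply]
  simp
  ring

/-- Polarisation of Parseval's identity applied to `f + g` and `f - g`. -/
theorem hasSum_mul_modes {f g : Torus → ℝ} (hf : MemLp f 2) (hg : MemLp g 2) :
    HasSum (fun k : ℤ => (∫ θ, f θ * cosMode k θ) * (∫ θ, g θ * cosMode k θ) +
      (∫ θ, f θ * sinMode k θ) * (∫ θ, g θ * sinMode k θ)) (∫ θ, f θ * g θ) := by
  have h1 := ((hasSum_sq_modes (hf.add hg)).sub (hasSum_sq_modes (hf.sub hg))).mul_left (1 / 4)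
  have hfi := integrable_of_memLp_two hf
  have hgi := integrable_of_memLp_two hg
  have ea : ∀ e : Torus → ℝ, Continuous e →
      ∫ θ, (f + g) θ * e θ = (∫ θ, f θ * e θ) + ∫ θ, g θ * e θ := fun e he => by
    rw [← integral_add (integrable_mul_of_continuous hfi he) (integrable_mul_of_continuous hgi he)]
    simp only [Pi.add_apply, add_mul]
  have es : ∀ e : Torus → ℝ, Continuous e →
      ∫ θ, (f - g) θ * e θ = (∫ θ, f θ * e θ) - ∫ θ, g θ * e θ := fun e he => by
    rw [← integral_sub (integrable_mul_of_continuous hfi he) (integrable_mul_of_continuous hgi he)]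
    simp only [Pi.sub_apply, sub_mul]
  convert! h1 using 1
  · funext k
    rw [ea _ (continuous_cosMode k), ea _ (continuous_sinMode k), es _ (continuous_cosMode k),
      es _ (continuous_sinMode k)]
    ring
  · rw [← integral_sub (hf.add hg).integrable_sq (hf.sub hg).integrable_sq, ← integral_const_mul]
    refine integral_congr_ae (ae_of_all _ fun θ => ?_)
    simp only [Pi.add_apply, Pi.sub_apply]
    ring

/-- Bessel's inequality, with the square integral bounded through the uniform bound. -/
theorem sum_sq_modes_le {f : Torus → ℝ} (hf : Measurable f) {K : ℝ} (hK : ∀ θ, |f θ| ≤ K)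
    (S : Finset ℤ) :
    ∑ k ∈ S, ((∫ θ, f θ * cosMode k θ) ^ 2 + (∫ θ, f θ * sinMode k θ) ^ 2) ≤ K ^ 2 := by
  have hL : MemLp f 2 := MemLp.of_bound hf.aestronglyMeasurable K (ae_of_all _ hK)
  refine (sum_le_hasSum S (fun k _ => by positivity) (hasSum_sq_modes hL)).trans ?_
  have : ∫ _ : Torus, K ^ 2 = K ^ 2 := by simp [measureReal_def]
  rw [← this]
  exact integral_mono hL.integrable_sq (integrable_const _) fun θ =>
    sq_le_sq' (abs_le.1 (hK θ)).1 (abs_le.1 (hK θ)).2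

/-- The pairing of a function with a derivative is controlled by its Dirichlet energy. -/
theorem ofReal_pairing_le {u : Torus → ℝ} (hu : MemLp u 2) {g g' : Torus → ℝ} (hg : HasDx g g') :
    ENNReal.ofReal (2 * (∫ θ, u θ * g' θ) - ∫ θ, g θ ^ 2) ≤
      ∑' k : ℤ, ENNReal.ofReal (freq k ^ 2 *
        ((∫ θ, u θ * cosMode k θ) ^ 2 + (∫ θ, u θ * sinMode k θ) ^ 2)) := by
  have hgc := hg.continuous
  have hg'c := hg.cont
  have mem : ∀ f : Torus → ℝ, Continuous f → MemLp f 2 := fun f hf => by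
    obtain ⟨C, hC⟩ := isCompact_univ.exists_bound_of_continuousOn hf.continuousOn
    exact MemLp.of_bound hf.aestronglyMeasurable C (ae_of_all _ fun θ => hC θ (mem_univ _))
  have h := ((hasSum_mul_modes hu (mem g' hg'c)).mul_left 2).sub (hasSum_sq_modes (mem g hgc))
  -- Differentiation exchanges the cosine and sine coefficients and multiplies them by the
  -- frequency, up to sign. The estimate can then be completed to squares in each mode separately.
  have e1 : ∀ k, ∫ θ, g' θ * cosMode k θ = freq k * ∫ θ, g θ * sinMode k θ := fun k => by
    have := hg.integral_mul (hasDx_cosMode k)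
    rw [← neg_eq_iff_eq_neg, ← integral_neg] at this
    rw [← this, ← integral_const_mul]
    congr 1; funext θ; ring
  have e2 : ∀ k, ∫ θ, g' θ * sinMode k θ = -(freq k * ∫ θ, g θ * cosMode k θ) := fun k => by
    have := hg.integral_mul (hasDx_sinMode k)
    rw [← neg_eq_iff_eq_neg] at this
    rw [← this, ← integral_const_mul]
    congr 2; funext θ; ring
  refine le_of_tendsto ((ENNReal.continuous_ofReal.tendsto _).comp h) (Eventually.of_forall
    fun S => ?_)
  refine le_trans ?_ (ENNReal.sum_le_tsum S)
  rw [Function.comp, ← ENNReal.ofReal_sum_of_nonneg fun k _ => by positivity]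
  refine ENNReal.ofReal_le_ofReal (Finset.sum_le_sum fun k _ => ?_)
  rw [e1, e2]
  set a := ∫ θ, u θ * cosMode k θ
  set b := ∫ θ, u θ * sinMode k θ
  set p := ∫ θ, g θ * cosMode k θ
  set q := ∫ θ, g θ * sinMode k θ
  nlinarith [sq_nonneg (freq k * a - q), sq_nonneg (freq k * b + p)]

/-! ### Entire solutions of the reaction-diffusion equation -/

/-- `ρ` solves the reaction-diffusion equation for all times in `ℝ`. -/
def IsEntireSolution (c : Config → ℝ) (ρ : ℝ → Profile) : Prop :=
  ∀ s T : ℝ, 0 < T → IsWeakSolution c T (ρ s) (fun t => ρ (s + t))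

/-- A time-independent test function. -/
def TestC12.const (T : ℝ) {g g' g'' : Torus → ℝ} (h : HasDx g g') (h' : HasDx g' g'') :
    TestC12 T where
  fn := fun _ => g
  dt := fun _ _ => 0
  dx := fun _ => g'
  dxx := fun _ => g''
  cont_fn := (h.continuous.comp continuous_snd).continuousOn
  cont_dt := continuousOn_const
  cont_dx := (h.cont.comp continuous_snd).continuousOn
  cont_dxx := (h'.cont.comp continuous_snd).continuousOn
  hasDeriv_dt := fun _ _ _ => hasDerivWithinAt_const _ _ _
  hasDeriv_dx := fun _ _ => h.deriv
  hasDeriv_dxx := fun _ _ => h'.deriv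

section
variable {c : Config → ℝ} {ρ : ℝ → Profile}

theorem IsEntireSolution.measurable (h : IsEntireSolution c ρ) :
    Measurable fun p : ℝ × Torus => ρ p.1 p.2 := by
  -- Measurability is known on bounded time layers only. Clamping time to `[-N n, N n]` gives
  -- measurable functions which at each point are eventually equal to `ρ`.
  let N : ℕ → ℝ := fun n => n + 1
  have hN : ∀ n, 0 < N n := fun n => by positivity
  have hm : ∀ n, Measurable fun p : ℝ × Torus =>
      ρ (-N n + projIcc 0 (2 * N n) (by linarith [hN n]) (p.1 + N n)) p.2 := fun n => by
    have h1 := (h (-N n) (2 * N n) (by linarith [hN n])).1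
    have h2 : Measurable fun p : ℝ × Torus =>
        (projIcc 0 (2 * N n) (by linarith [hN n]) (p.1 + N n), p.2) :=
      ((continuous_projIcc.comp (continuous_fst.add continuous_const)).prodMk
        continuous_snd).measurable
    exact h1.comp h2
  refine measurable_of_tendsto_metrizable hm (tendsto_pi_nhds.2 fun p => ?_)
  refine tendsto_const_nhds.congr' ?_
  obtain ⟨n₀, hn₀⟩ := exists_nat_ge |p.1|
  filter_upwards [eventually_ge_atTop n₀] with n hn
  have h1 : |p.1| ≤ N n := by
    have : (n₀ : ℝ) ≤ n := by exact_mod_cast hn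
    simp only [N]; linarith
  have h2 := abs_le.1 h1
  rw [projIcc_of_mem _ ⟨by linarith, by linarith⟩]
  congr 2
  simp

theorem exists_reaction_bound (hc : IsCylinder c) :
    ∃ K : ℝ, ∀ r ∈ Icc (0 : ℝ) 1, |reaction c r| ≤ K :=
  isCompact_Icc.exists_bound_of_continuousOn (continuous_reaction hc).continuousOn

theorem IsEntireSolution.shift (h : IsEntireSolution c ρ) (s : ℝ) :
    IsEntireSolution c fun t => ρ (s + t) := fun r T hT => by
  simpa only [add_assoc] using h (s + r) T hT

/-- The rate of change of `⟨ρ_t, g⟩`, where `g''` is the second derivative of `g`. -/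
noncomputable def drift (c : Config → ℝ) (ρ : ℝ → Profile) (g g'' : Torus → ℝ) (t : ℝ) : ℝ :=
  1 / 2 * (∫ θ, ρ t θ * g'' θ) + ∫ θ, reaction c (ρ t θ) * g θ

theorem bddMeas_mul_const {u : ℝ → Profile} (hu : Measurable fun p : ℝ × Torus => u p.1 p.2)
    {Φ : ℝ → ℝ} (hΦ : Continuous Φ) {g : Torus → ℝ} (hg : Continuous g) (T : ℝ) :
    BddMeas T fun p => Φ (u p.1 p.2) * g p.2 :=
  ((bddMeas_profile hu T).comp hΦ).mul (.of_continuousOn (hg.comp continuous_snd).continuousOn)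

/-- The weak formulation on a layer started at time `s`, tested with a function independent of time.
-/
theorem integral_sub_eq_integral_drift (hc : IsCylinder c) (h : IsEntireSolution c ρ)
    {g g' g'' : Torus → ℝ} (hg : HasDx g g') (hg' : HasDx g' g'') {s t : ℝ} (hst : s ≤ t) :
    (∫ θ, ρ t θ * g θ) - (∫ θ, ρ s θ * g θ) = ∫ r in s..t, drift c ρ g g'' r := by
  rcases hst.eq_or_lt with rfl | hst
  · simp
  have hT : 0 < t - s := sub_pos.2 hst
  have key := (h s (t - s) hT).2 (TestC12.const (t - s) hg hg')
  have hm := (h.shift s).measurable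
  have i1 := (bddMeas_mul_const (u := fun t => ρ (s + t)) hm continuous_id hg'.cont (t - s)).intervalIntegrable hT.le
  have i2 := (bddMeas_mul_const (u := fun t => ρ (s + t)) hm (continuous_reaction hc) hg.continuous
    (t - s)).intervalIntegrable hT.le
  have e := intervalIntegral.integral_comp_add_left (a := 0) (b := t - s) (drift c ρ g g'') s
  rw [add_zero, add_sub_cancel] at e
  rw [← e]
  simp only [id] at i1
  dsimp only at i2
  unfold drift
  rw [intervalIntegral.integral_add (i1.const_mul _) i2, intervalIntegral.integral_const_mul]
  simpa [TestC12.const] using key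

theorem abs_integral_torus_le {f : Torus → ℝ} {C : ℝ} (hC : ∀ θ, |f θ| ≤ C) : |∫ θ, f θ| ≤ C := by
  have := norm_integral_le_of_norm_le_const (μ := (volume : Measure Torus)) (f := f) (C := C)
    (ae_of_all _ hC)
  simpa [measureReal_def] using this

theorem exists_drift_bound (hc : IsCylinder c) (ρ : ℝ → Profile) {g g'' : Torus → ℝ}
    (hg : Continuous g) (hg'' : Continuous g'') :
    ∃ C : NNReal, ∀ t, |drift c ρ g g'' t| ≤ C := by
  obtain ⟨C, hC⟩ := isCompact_univ.exists_bound_of_continuousOn hg.continuousOn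
  obtain ⟨C', hC'⟩ := isCompact_univ.exists_bound_of_continuousOn hg''.continuousOn
  obtain ⟨K, hK⟩ := exists_reaction_bound hc
  refine ⟨Real.toNNReal (1 / 2 * (1 * C') + K * C), fun t => le_trans ?_ (Real.le_coe_toNNReal _)⟩
  have h1 : |∫ θ, ρ t θ * g'' θ| ≤ 1 * C' := abs_integral_torus_le fun θ => by
    rw [abs_mul]
    have := (ρ t).mem_Icc θ
    exact mul_le_mul (abs_le.2 ⟨by linarith [this.1], this.2⟩) (hC' θ (mem_univ _))
      (abs_nonneg _) zero_le_one
  have h2 : |∫ θ, reaction c (ρ t θ) * g θ| ≤ K * C := abs_integral_torus_le fun θ => by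
    rw [abs_mul]
    have := hK _ ((ρ t).mem_Icc θ)
    exact mul_le_mul this (hC θ (mem_univ _)) (abs_nonneg _) ((abs_nonneg _).trans this)
  unfold drift
  refine (abs_add_le _ _).trans (add_le_add ?_ h2)
  rw [abs_mul, abs_of_pos (by norm_num : (0 : ℝ) < 1 / 2)]
  linarith

/-- Densities lie in `[0,1]`, where the reaction term is bounded, so the drift is bounded uniformly
in time. -/
theorem exists_lipschitz (hc : IsCylinder c) (h : IsEntireSolution c ρ)
    {g g' g'' : Torus → ℝ} (hg : HasDx g g') (hg' : HasDx g' g'') :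
    ∃ C : NNReal, LipschitzWith C fun t => ∫ θ, ρ t θ * g θ := by
  obtain ⟨C, hC⟩ := exists_drift_bound hc ρ hg.continuous hg'.cont
  refine ⟨C, LipschitzWith.of_dist_le_mul fun s t => ?_⟩
  wlog hst : s ≤ t generalizing s t
  · rw [dist_comm, dist_comm s]; exact this t s (le_of_not_ge hst)
  rw [dist_comm, dist_comm s, Real.dist_eq, Real.dist_eq,
    integral_sub_eq_integral_drift hc h hg hg' hst]
  exact intervalIntegral.norm_integral_le_of_norm_le_const (f := drift c ρ g g'') fun r _ => hC r

theorem hasDx_hasDx_cosMode (k : ℤ) :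
    HasDx (fun θ => -freq k * sinMode k θ) (fun θ => -freq k * (freq k * cosMode k θ)) :=
  (hasDx_sinMode k).const_mul _

theorem hasDx_hasDx_sinMode (k : ℤ) :
    HasDx (fun θ => freq k * cosMode k θ) (fun θ => freq k * (-freq k * sinMode k θ)) :=
  (hasDx_cosMode k).const_mul _

theorem continuous_integral_cosMode (hc : IsCylinder c) (h : IsEntireSolution c ρ) (k : ℤ) :
    Continuous fun t => ∫ θ, ρ t θ * cosMode k θ :=
  (exists_lipschitz hc h (hasDx_cosMode k) (hasDx_hasDx_cosMode k)).choose_spec.continuous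

theorem continuous_integral_sinMode (hc : IsCylinder c) (h : IsEntireSolution c ρ) (k : ℤ) :
    Continuous fun t => ∫ θ, ρ t θ * sinMode k θ :=
  (exists_lipschitz hc h (hasDx_sinMode k) (hasDx_hasDx_sinMode k)).choose_spec.continuous

theorem Profile.integrable_mul_complex (γ : Profile) (F : C(Torus, ℂ)) :
    Integrable fun θ => (γ θ : ℂ) * F θ :=
  (F.continuous.integrable_of_hasCompactSupport (.of_compactSpace F)).bdd_mul (c := 1)
    (Complex.measurable_ofReal.comp γ.measurable_toFun).aestronglyMeasurable
    (ae_of_all _ fun θ => by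
      have := γ.mem_Icc θ
      simp only [Complex.norm_real, Real.norm_eq_abs]
      exact abs_le.2 ⟨by linarith [this.1], this.2⟩)

/-- Entire solutions are weakly continuous in time. -/
theorem IsEntireSolution.continuous_integral (hc : IsCylinder c) (h : IsEntireSolution c ρ)
    {f : Torus → ℝ} (hf : Continuous f) : Continuous fun t => ∫ θ, ρ t θ * f θ := by
  -- `S` consists of the test functions whose pairing with the solution is continuous in time. It
  -- contains the Fourier modes and is closed under uniform limits, so it is everything.
  let S : Submodule ℂ C(Torus, ℂ) :=
    { carrier := {F | Continuous fun t => ∫ θ, (ρ t θ : ℂ) * F θ}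
      add_mem' := fun {F G} hF hG => by
        have : (fun t => ∫ θ, (ρ t θ : ℂ) * (F + G) θ) =
            fun t => (∫ θ, (ρ t θ : ℂ) * F θ) + ∫ θ, (ρ t θ : ℂ) * G θ := by
          funext t
          rw [← integral_add ((ρ t).integrable_mul_complex F) ((ρ t).integrable_mul_complex G)]
          simp only [ContinuousMap.add_apply, mul_add]
        simp only [mem_ofPred_eq, this]
        exact hF.add hG
      zero_mem' := by simp [continuous_const]
      smul_mem' := fun a F hF => by
        have : (fun t => ∫ θ, (ρ t θ : ℂ) * (a • F) θ) =
            fun t => a * ∫ θ, (ρ t θ : ℂ) * F θ := by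
          funext t
          rw [← integral_const_mul]
          congr 1; funext θ
          simp only [ContinuousMap.smul_apply, smul_eq_mul]; ring
        simp only [mem_ofPred_eq, this]
        exact hF.const_mul a }
  have hspan : Submodule.span ℂ (range (fourier (T := 1))) ≤ S := by
    rw [Submodule.span_le]
    rintro _ ⟨k, rfl⟩
    have h1 := (Complex.continuous_ofReal.comp (continuous_integral_cosMode hc h k)).add
      ((Complex.continuous_ofReal.comp (continuous_integral_sinMode hc h k)).mul_const Complex.I)
    refine h1.congr fun t => ?_
    simp only [Function.comp, Pi.add_apply]
    have ic := (ρ t).integrable_mul (integrable_of_continuous (continuous_cosMode k))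
    have is := (ρ t).integrable_mul (integrable_of_continuous (continuous_sinMode k))
    rw [← integral_complex_ofReal, ← integral_complex_ofReal, ← integral_mul_const,
      ← integral_add ic.ofReal (is.ofReal.mul_const _)]
    refine integral_congr_ae (ae_of_all _ fun θ => ?_)
    apply Complex.ext <;> simp [cosMode, sinMode]
  have hclosed : S.topologicalClosure ≤ S := by
    intro F hF
    rw [← SetLike.mem_coe, Submodule.topologicalClosure_coe, Metric.mem_closure_iff] at hF
    -- As `0 ≤ ρ ≤ 1` and the torus has mass one, replacing `F` by `G` changes the pairing by at
    -- most `dist F G`, uniformly in time.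
    refine continuous_of_uniform_approx_of_continuous fun U hU => ?_
    obtain ⟨ε, hε, hU⟩ := Metric.mem_uniformity_dist.1 hU
    obtain ⟨G, hG, hFG⟩ := hF ε hε
    refine ⟨_, hG, fun t => hU (lt_of_le_of_lt ?_ hFG)⟩
    rw [dist_eq_norm, ← integral_sub ((ρ t).integrable_mul_complex F)
      ((ρ t).integrable_mul_complex G)]
    have := norm_integral_le_of_norm_le_const (μ := (volume : Measure Torus)) (C := dist F G)
      (f := fun θ => (ρ t θ : ℂ) * F θ - (ρ t θ : ℂ) * G θ) (ae_of_all _ fun θ => by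
        rw [← mul_sub, norm_mul, Complex.norm_real, Real.norm_eq_abs,
          abs_of_nonneg ((ρ t).mem_Icc θ).1]
        have h1 : ‖F θ - G θ‖ ≤ dist F G := by
          rw [← dist_eq_norm]; exact ContinuousMap.dist_apply_le_dist θ
        have h2 := ((ρ t).mem_Icc θ).2
        have h3 := ((ρ t).mem_Icc θ).1
        nlinarith [norm_nonneg (F θ - G θ)])
    simpa [measureReal_def] using this
  have hall : ∀ F : C(Torus, ℂ), F ∈ S := fun F => by
    have h1 : F ∈ (Submodule.span ℂ (range (fourier (T := 1)))).topologicalClosure := by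
      rw [span_fourier_closure_eq_top]; trivial
    exact hclosed (Submodule.topologicalClosure_mono hspan h1)
  have hF : Continuous fun t => ∫ θ, (ρ t θ : ℂ) * (f θ : ℂ) :=
    hall ⟨fun θ => (f θ : ℂ), Complex.continuous_ofReal.comp hf⟩
  refine (Complex.continuous_re.comp hF).congr fun t => ?_
  simp only [Function.comp, ← Complex.ofReal_mul, integral_complex_ofReal, Complex.ofReal_re]

end

/-! ### Energy of entire solutions -/

/-- The chain rule for the square of a Lipschitz primitive. -/
theorem sq_sub_sq_eq_integral {a r : ℝ → ℝ} {C : NNReal} (ha : LipschitzWith C a) {L : ℝ}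
    (hL : 0 ≤ L) (hr : IntervalIntegrable r volume 0 L)
    (h : ∀ t ∈ Icc 0 L, a t - a 0 = ∫ s in 0..t, r s) :
    a L ^ 2 - a 0 ^ 2 = ∫ t in 0..L, 2 * (a t * r t) := by
  have hac : AbsolutelyContinuousOnInterval a 0 L :=
    LipschitzOnWith.absolutelyContinuousOnInterval ha.lipschitzOnWith
  have key := hac.integral_deriv_mul_eq_sub hac
  rw [sq, sq, ← key]
  refine intervalIntegral.integral_congr_ae ?_
  -- The primitive formula holds only inside `[0,L]`; excluding the endpoint makes it valid in a
  -- neighbourhood of `t`, as needed for the derivative.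
  have hne : ∀ᵐ t : ℝ, t ≠ L := by simp [ae_iff, measure_singleton]
  filter_upwards [hr.ae_hasDerivAt_integral, hne] with t ht hne htI
  have hd := ht (uIoc_subset_uIcc htI) 0 (by simp)
  rw [uIoc_of_le hL] at htI
  have hd' : HasDerivAt a (r t) t := by
    have := hd.add_const (a 0)
    refine this.congr_of_eventuallyEq ?_
    filter_upwards [Ioo_mem_nhds htI.1 (lt_of_le_of_ne htI.2 hne)] with s hs
    rw [← h s (Ioo_subset_Icc_self hs)]
    simp
  rw [hd'.deriv]
  ring

section
variable {c : Config → ℝ} {ρ : ℝ → Profile}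

theorem intervalIntegrable_reaction_sq (hc : IsCylinder c) (h : IsEntireSolution c ρ)
    {g : Torus → ℝ} (hg : Continuous g) {L : ℝ} (hL : 0 ≤ L) :
    IntervalIntegrable (fun t => (∫ θ, reaction c (ρ t θ) * g θ) ^ 2) volume 0 L := by
  have hfi : IntervalIntegrable (fun t => ∫ θ, reaction c (ρ t θ) * g θ) volume 0 L :=
    (bddMeas_mul_const h.measurable (continuous_reaction hc) hg L).intervalIntegrable hL
  obtain ⟨K, hK⟩ := exists_reaction_bound hc
  obtain ⟨D, hD⟩ := isCompact_univ.exists_bound_of_continuousOn hg.continuousOn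
  simp only [sq]
  rw [intervalIntegrable_iff] at hfi ⊢
  refine Integrable.mul_bdd (c := K * D) hfi hfi.aestronglyMeasurable (ae_of_all _ fun t => ?_)
  refine abs_integral_torus_le fun θ => ?_
  rw [abs_mul]
  have := hK _ ((ρ t).mem_Icc θ)
  exact mul_le_mul this (hD θ (mem_univ _)) (abs_nonneg _) ((abs_nonneg _).trans this)

/-- For an eigenfunction `g` the coefficient `a` satisfies `a' = -(κ²/2) a + f`, where `f` is the
coefficient of the reaction term. Integrating the derivative of `a²`, using `2 a f ≤ a² + f²` and
dropping `a(L)²` gives the bound. -/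
theorem mode_energy_le (hc : IsCylinder c) (h : IsEntireSolution c ρ) {g g' : Torus → ℝ} {κ : ℝ}
    (hg : HasDx g g') (hg' : HasDx g' (fun θ => -(κ ^ 2) * g θ)) {L : ℝ} (hL : 0 ≤ L) :
    κ ^ 2 * ∫ t in 0..L, (∫ θ, ρ t θ * g θ) ^ 2 ≤ (∫ θ, ρ 0 θ * g θ) ^ 2 +
      ∫ t in 0..L, ((∫ θ, ρ t θ * g θ) ^ 2 + (∫ θ, reaction c (ρ t θ) * g θ) ^ 2) := by
  obtain ⟨C, hC⟩ := exists_lipschitz hc h hg hg'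
  have i2 := bddMeas_mul_const h.measurable (continuous_reaction hc) hg.continuous L
  set a : ℝ → ℝ := fun t => ∫ θ, ρ t θ * g θ with ha
  set f : ℝ → ℝ := fun t => ∫ θ, reaction c (ρ t θ) * g θ with hf
  have hfi : IntervalIntegrable f volume 0 L := i2.intervalIntegrable hL
  have hdr : ∀ t, drift c ρ g (fun θ => -(κ ^ 2) * g θ) t = -(κ ^ 2 / 2) * a t + f t := fun t => by
    have : ∫ θ, ρ t θ * (-(κ ^ 2) * g θ) = -(κ ^ 2) * a t := by
      rw [ha, ← integral_const_mul]; congr 1; funext θ; ring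
    rw [drift, this]; ring
  have hac := hC.continuous
  have key := sq_sub_sq_eq_integral hC hL (r := fun t => -(κ ^ 2 / 2) * a t + f t)
    (((hac.intervalIntegrable _ _).const_mul _).add hfi) fun t ht => by
      rw [integral_sub_eq_integral_drift hc h hg hg' ht.1]
      simp only [hdr]
  have hf2 : IntervalIntegrable (fun t => f t ^ 2) volume 0 L :=
    intervalIntegrable_reaction_sq hc h hg.continuous hL
  have haf : IntervalIntegrable (fun t => a t * f t) volume 0 L :=
    hfi.continuousOn_mul hac.continuousOn
  have ha2 : IntervalIntegrable (fun t => a t ^ 2) volume 0 L :=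
    (hac.pow 2).intervalIntegrable _ _
  have e : ∫ t in 0..L, 2 * (a t * (-(κ ^ 2 / 2) * a t + f t)) =
      -(κ ^ 2) * (∫ t in 0..L, a t ^ 2) + ∫ t in 0..L, 2 * (a t * f t) := by
    rw [← intervalIntegral.integral_const_mul, ← intervalIntegral.integral_add
      (ha2.const_mul _) (haf.const_mul _)]
    congr 1; funext t; ring
  rw [e] at key
  have le : ∫ t in 0..L, 2 * (a t * f t) ≤ ∫ t in 0..L, (a t ^ 2 + f t ^ 2) :=
    intervalIntegral.integral_mono_on hL (haf.const_mul _) (ha2.add hf2) fun t _ => by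
      nlinarith [sq_nonneg (a t - f t)]
  have := sq_nonneg (a L)
  linarith

/-- The squared modulus of a Fourier coefficient. -/
noncomputable def modeSq (f : Torus → ℝ) (k : ℤ) : ℝ :=
  (∫ θ, f θ * cosMode k θ) ^ 2 + (∫ θ, f θ * sinMode k θ) ^ 2

theorem continuous_modeSq (hc : IsCylinder c) (h : IsEntireSolution c ρ) (k : ℤ) :
    Continuous fun t => modeSq (ρ t) k :=
  ((continuous_integral_cosMode hc h k).pow 2).add ((continuous_integral_sinMode hc h k).pow 2)

theorem modeSq_nonneg (f : Torus → ℝ) (k : ℤ) : 0 ≤ modeSq f k := by unfold modeSq; positivity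

theorem modeSq_energy_le (hc : IsCylinder c) (h : IsEntireSolution c ρ) (k : ℤ) {L : ℝ}
    (hL : 0 ≤ L) : ∫ t in 0..L, freq k ^ 2 * modeSq (ρ t) k ≤ modeSq (ρ 0) k +
      ∫ t in 0..L, (modeSq (ρ t) k + modeSq (fun θ => reaction c (ρ t θ)) k) := by
  have e1 : HasDx (fun θ => -freq k * sinMode k θ) (fun θ => -(freq k ^ 2) * cosMode k θ) := by
    convert! hasDx_hasDx_cosMode k using 2; ring
  have e2 : HasDx (fun θ => freq k * cosMode k θ) (fun θ => -(freq k ^ 2) * sinMode k θ) := by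
    convert! hasDx_hasDx_sinMode k using 2; ring
  have h1 := mode_energy_le hc h (hasDx_cosMode k) e1 hL
  have h2 := mode_energy_le hc h (hasDx_sinMode k) e2 hL
  have ic : IntervalIntegrable (fun t => (∫ θ, ρ t θ * cosMode k θ) ^ 2) volume 0 L :=
    ((continuous_integral_cosMode hc h k).pow 2).intervalIntegrable _ _
  have is : IntervalIntegrable (fun t => (∫ θ, ρ t θ * sinMode k θ) ^ 2) volume 0 L :=
    ((continuous_integral_sinMode hc h k).pow 2).intervalIntegrable _ _
  have fc := intervalIntegrable_reaction_sq hc h (continuous_cosMode k) hL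
  have fs := intervalIntegrable_reaction_sq hc h (continuous_sinMode k) hL
  unfold modeSq
  dsimp only
  rw [intervalIntegral.integral_const_mul, intervalIntegral.integral_add ic is,
    intervalIntegral.integral_add (ic.add is) (fc.add fs), intervalIntegral.integral_add ic is,
    intervalIntegral.integral_add fc fs]
  rw [intervalIntegral.integral_add ic fc] at h1
  rw [intervalIntegral.integral_add is fs] at h2
  linarith

/-- Bessel's inequality bounds the sums over modes by `1` for the solution and by `K²` for the
reaction term, whatever the finite set of modes. -/
theorem sum_modeSq_energy_le (hc : IsCylinder c) (h : IsEntireSolution c ρ) {K : ℝ}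
    (hK : ∀ r ∈ Icc (0 : ℝ) 1, |reaction c r| ≤ K) {L : ℝ} (hL : 0 ≤ L) (S : Finset ℤ) :
    ∑ k ∈ S, ∫ t in 0..L, freq k ^ 2 * modeSq (ρ t) k ≤ 1 + L * (1 + K ^ 2) := by
  refine (Finset.sum_le_sum fun k _ => modeSq_energy_le hc h k hL).trans ?_
  have ii : ∀ k ∈ S, IntervalIntegrable
      (fun t => modeSq (ρ t) k + modeSq (fun θ => reaction c (ρ t θ)) k) volume 0 L := fun k _ =>
    ((continuous_modeSq hc h k).intervalIntegrable _ _).add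
      ((intervalIntegrable_reaction_sq hc h (continuous_cosMode k) hL).add
        (intervalIntegrable_reaction_sq hc h (continuous_sinMode k) hL))
  rw [Finset.sum_add_distrib, ← intervalIntegral.integral_finsetSum ii]
  have b1 : ∀ t, ∑ k ∈ S, modeSq (ρ t) k ≤ 1 := fun t => by
    have := sum_sq_modes_le (ρ t).measurable_toFun (K := 1) (fun θ => by
      have := (ρ t).mem_Icc θ
      exact abs_le.2 ⟨by linarith [this.1], this.2⟩) S
    simpa [modeSq] using this
  have b2 : ∀ t, ∑ k ∈ S, modeSq (fun θ => reaction c (ρ t θ)) k ≤ K ^ 2 := fun t =>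
    sum_sq_modes_le ((continuous_reaction hc).measurable.comp (ρ t).measurable_toFun)
      (fun θ => hK _ ((ρ t).mem_Icc θ)) S
  refine add_le_add (b1 0) ?_
  have e : L * (1 + K ^ 2) = ∫ _ in 0..L, (1 + K ^ 2) := by simp; ring
  rw [e]
  refine intervalIntegral.integral_mono_on hL ?_ (by simp) fun t _ => ?_
  · have := IntervalIntegrable.sum S ii
    exact this.congr fun t _ => by simp
  · rw [Finset.sum_add_distrib]
    exact add_le_add (b1 t) (b2 t)

theorem integral_le_of_lintegral_ofReal_le {X : Type*} [MeasurableSpace X] {μ : Measure X}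
    {F : X → ℝ} (hF : Integrable F μ) {C : ℝ} (hC : 0 ≤ C)
    (h : ∫⁻ x, ENNReal.ofReal (F x) ∂μ ≤ ENNReal.ofReal C) : ∫ x, F x ∂μ ≤ C := by
  rw [integral_eq_lintegral_pos_part_sub_lintegral_neg_part hF]
  have h1 := ENNReal.toReal_le_of_le_ofReal hC h
  have h2 : 0 ≤ (∫⁻ x, ENNReal.ofReal (-F x) ∂μ).toReal := ENNReal.toReal_nonneg
  linarith

/-- The Dirichlet energy of an entire solution is integrable in time. -/
theorem lintegral_dirichlet_le (hc : IsCylinder c) (h : IsEntireSolution c ρ) {K : ℝ}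
    (hK : ∀ r ∈ Icc (0 : ℝ) 1, |reaction c r| ≤ K) {L : ℝ} (hL : 0 ≤ L) :
    ∫⁻ t in Ioc 0 L, ∑' k : ℤ, ENNReal.ofReal (freq k ^ 2 * modeSq (ρ t) k) ≤
      ENNReal.ofReal (1 + L * (1 + K ^ 2)) := by
  have hcont : ∀ k, Continuous fun t => freq k ^ 2 * modeSq (ρ t) k := fun k =>
    (continuous_modeSq hc h k).const_mul _
  have hnn : ∀ k t, 0 ≤ freq k ^ 2 * modeSq (ρ t) k := fun k t =>
    mul_nonneg (sq_nonneg _) (modeSq_nonneg _ _)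
  rw [lintegral_tsum fun k => (hcont k).measurable.ennreal_ofReal.aemeasurable]
  refine ENNReal.summable.tsum_le_of_sum_le fun S => ?_
  refine le_trans (le_of_eq ?_) (ENNReal.ofReal_le_ofReal (sum_modeSq_energy_le hc h hK hL S))
  rw [ENNReal.ofReal_sum_of_nonneg fun k _ =>
    intervalIntegral.integral_nonneg hL fun t _ => hnn k t]
  refine Finset.sum_congr rfl fun k _ => ?_
  rw [intervalIntegral.integral_of_le hL, ofReal_integral_eq_lintegral_ofReal
    ((hcont k).integrableOn_Ioc) (ae_of_all _ (hnn k))]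

/-- At each time the pairing is dominated by the Dirichlet energy. The latter may be infinite at
some times, so the comparison is made in extended nonnegative reals before integrating over time. -/
theorem IsEntireSolution.energy_le (hc : IsCylinder c) (h : IsEntireSolution c ρ) {K : ℝ}
    (hK : ∀ r ∈ Icc (0 : ℝ) 1, |reaction c r| ≤ K) {L : ℝ} (hL : 0 ≤ L) (G : TestC01 L) :
    ∫ p, (2 * (ρ p.1 p.2 * G.dx p.1 p.2) - G.fn p.1 p.2 ^ 2) ∂(layer L) ≤
      1 + L * (1 + K ^ 2) := by
  have hb := bddMeas_energyDensity h.measurable G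
  rw [← hb.integral_eq hL, intervalIntegral.integral_of_le hL]
  have hi := (intervalIntegrable_iff_integrableOn_Ioc_of_le hL).1 (hb.intervalIntegrable hL)
  refine integral_le_of_lintegral_ofReal_le hi (by positivity) ?_
  refine le_trans (setLIntegral_mono' measurableSet_Ioc fun t ht => ?_)
    (lintegral_dirichlet_le hc h hK hL)
  have htI := Ioc_subset_Icc_self ht
  have hG : HasDx (G.fn t) (G.dx t) := ⟨continuous_section G.cont_dx htI, G.hasDeriv_dx t htI⟩
  have hGc := hG.continuous
  have hmem : MemLp (ρ t) 2 := MemLp.of_bound (ρ t).measurable_toFun.aestronglyMeasurable 1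
    (ae_of_all _ fun θ => by
      have := (ρ t).mem_Icc θ
      exact abs_le.2 ⟨by linarith [this.1], this.2⟩)
  refine le_trans (le_of_eq ?_) (ofReal_pairing_le hmem hG)
  dsimp only
  rw [integral_sub (((ρ t).integrable_mul (integrable_of_continuous hG.cont)).const_mul _)
    (integrable_of_continuous (by fun_prop)), integral_const_mul]

/-- Solutions of the reaction-diffusion equation have no dynamical cost. -/
theorem IsEntireSolution.cost_nonpos (hpos : ∀ η, 0 < c η) (hc : IsCylinder c)
    (h : IsEntireSolution c ρ) {L : ℝ} (hL : 0 < L) (G : TestC12 L) :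
    (∫ θ, ρ L θ * G.fn L θ) - (∫ θ, ρ 0 θ * G.fn 0 θ)
      - ∫ p, costDensity c ρ G p ∂(layer L) ≤ 0 := by
  have hw := (h 0 L hL).2 G
  simp only [zero_add] at hw
  have mu := bddMeas_profile h.measurable L
  have m1 := mu.mul G.bddMeas_dt
  have m2 := mu.mul G.bddMeas_dxx
  have m3 := (mu.comp (continuous_reaction hc)).mul G.bddMeas_fn
  have mK := bddMeas_costDensity hc h.measurable G
  rw [m1.integral_eq hL.le, m2.integral_eq hL.le, m3.integral_eq hL.le] at hw
  -- The weak formulation with the same `G` replaces the boundary terms. The linear terms in `∂ₜG`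
  -- and `ΔG` cancel, and what remains is `F G` minus the gradient and exponential terms.
  have e : (∫ θ, ρ L θ * G.fn L θ) - (∫ θ, ρ 0 θ * G.fn 0 θ)
      - ∫ p, costDensity c ρ G p ∂(layer L) =
      ∫ p, (ρ p.1 p.2 * G.dt p.1 p.2 + 1 / 2 * (ρ p.1 p.2 * G.dxx p.1 p.2)
        + reaction c (ρ p.1 p.2) * G.fn p.1 p.2 - costDensity c ρ G p) ∂(layer L) := by
    rw [integral_sub ((m1.add (m2.const_mul _)).add m3).integrable mK.integrable,
      integral_add (m1.add (m2.const_mul _)).integrable m3.integrable,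
      integral_add m1.integrable (m2.const_mul _).integrable, integral_const_mul]
    linarith
  rw [e]
  refine integral_nonpos fun p => ?_
  obtain ⟨m, M, hm, hM, hb⟩ := exists_birth_death_bounds hpos hc
  have hr := (ρ p.1).mem_Icc p.2
  obtain ⟨b1, -, d1, -⟩ := hb _ hr
  have hB : 0 ≤ birth c (ρ p.1 p.2) := le_trans (mul_nonneg hm.le (by linarith [hr.2])) b1
  have hD : 0 ≤ death c (ρ p.1 p.2) := le_trans (mul_nonneg hm.le hr.1) d1
  have hχ : 0 ≤ mobility (ρ p.1 p.2) := mul_nonneg hr.1 (by linarith [hr.2])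
  have e1 := mul_nonneg hB (show 0 ≤ Real.exp (G.fn p.1 p.2) - 1 - G.fn p.1 p.2 by
    linarith [Real.add_one_le_exp (G.fn p.1 p.2)])
  have e2 := mul_nonneg hD (show 0 ≤ Real.exp (-G.fn p.1 p.2) - 1 + G.fn p.1 p.2 by
    linarith [Real.add_one_le_exp (-G.fn p.1 p.2)])
  have e3 := mul_nonneg hχ (sq_nonneg (G.dx p.1 p.2))
  simp only [costDensity, reaction, Pi.zero_apply]
  linarith

theorem IsEntireSolution.cheapPath (hpos : ∀ η, 0 < c η) (hc : IsCylinder c)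
    (h : IsEntireSolution c ρ) {L : ℝ} (hL : 0 < L) : CheapPath c L ρ 0 where
  meas := h.measurable
  weak := fun _ hf => (h.continuous_integral hc hf).continuousOn
  energy := by
    obtain ⟨K, hK⟩ := exists_reaction_bound hc
    exact ⟨_, h.energy_le hc hK hL.le⟩
  cost := h.cost_nonpos hpos hc hL

end

/-! ### Connecting an orbit to its limits -/

theorem CheapPath.mono {c : Config → ℝ} {T : ℝ} {u : ℝ → Profile} {ε ε' : ℝ}
    (h : CheapPath c T u ε) (hε : ε ≤ ε') : CheapPath c T u ε' :=
  ⟨h.meas, h.weak, h.energy, fun G => (h.cost G).trans hε⟩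

/-- Profiles `C¹`-close to a stationary solution are connected to it, in both directions, at a
small cost. -/
theorem exists_cheapPath_interp {c : Config → ℝ} (hpos : ∀ η, 0 < c η) (hc : IsCylinder c)
    {φ : Profile} (hφ : φ ∈ Stationary c) {ε : ℝ} (hε : 0 < ε) :
    ∃ φ' : Torus → ℝ, HasDx φ φ' ∧ ∃ η > 0, ∀ (σ : Profile) (σ' : Torus → ℝ), HasDx σ σ' →
      (∀ θ, |σ θ - φ θ| ≤ η) → (∀ θ, |σ' θ - φ' θ| ≤ η) →
      CheapPath c 1 (interp φ σ) ε ∧ CheapPath c 1 (interp σ φ) ε := by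
  obtain ⟨φ', φ'', h', h'', heq⟩ := exists_hasDx_of_stationary hφ
  obtain ⟨δ, hδ, hδφ⟩ := exists_stationary_bounds hpos hc hφ
  obtain ⟨m, M, hm, hM, hbd⟩ := exists_birth_death_bounds hpos hc
  set b := m * (δ / 2) with hbdef
  set χ₀ := (δ / 2) * (δ / 2) with hχdef
  have hb : 0 < b := by positivity
  have hχ₀ : 0 < χ₀ := by positivity
  -- These choices make each of `α² / (4 b)` and `β² / (8 χ₀)` equal to `ε / 2`.
  set α := Real.sqrt (2 * b * ε) with hα
  set β := Real.sqrt (4 * χ₀ * ε) with hβ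
  have hαpos : 0 < α := Real.sqrt_pos.2 (by positivity)
  have hβpos : 0 < β := Real.sqrt_pos.2 (by positivity)
  have hsum : α ^ 2 / (4 * b) + β ^ 2 / (8 * χ₀) ≤ ε := by
    rw [hα, hβ, Real.sq_sqrt (by positivity), Real.sq_sqrt (by positivity)]
    apply le_of_eq
    field_simp
    ring
  have huc := isCompact_Icc.uniformContinuousOn_of_continuous
    (s := Icc (0 : ℝ) 1) (continuous_reaction hc).continuousOn
  obtain ⟨ξ, hξ, hF⟩ := Metric.uniformContinuousOn_iff.1 huc (α / 2) (by positivity)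
  -- The bounds `δ / 2` and `ξ / 2` keep the path away from `0` and `1` and the reaction term within
  -- `α / 2` of that of `φ`. The bounds `α / 2` and `β` control the difference of the endpoints and
  -- of their gradients.
  refine ⟨φ', h', min (min (δ / 2) (ξ / 2)) (min (α / 2) β), by positivity, ?_⟩
  set η := min (min (δ / 2) (ξ / 2)) (min (α / 2) β)
  have n1 : η ≤ δ / 2 := (min_le_left _ _).trans (min_le_left _ _)
  have n2 : η ≤ ξ / 2 := (min_le_left _ _).trans (min_le_right _ _)
  have n3 : η ≤ α / 2 := (min_le_right _ _).trans (min_le_left _ _)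
  have n4 : η ≤ β := (min_le_right _ _).trans (min_le_right _ _)
  intro σ σ' hσ hclose hclose'
  have key : ∀ u : Profile, (∀ θ, |u θ - φ θ| ≤ η) → ∀ θ,
      (b ≤ birth c (u θ) ∧ b ≤ death c (u θ) ∧ χ₀ ≤ mobility (u θ)) ∧
      |reaction c (φ θ) - reaction c (u θ)| ≤ α / 2 := by
    intro u hu θ
    have h1 := abs_le.1 (hu θ)
    have h2 := hδφ θ
    have l : δ / 2 ≤ u θ := by linarith [h1.1, h2.1]
    have r : δ / 2 ≤ 1 - u θ := by linarith [h1.2, h2.2]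
    obtain ⟨b1, -, d1, -⟩ := hbd _ (u.mem_Icc θ)
    refine ⟨⟨(mul_le_mul_of_nonneg_left r hm.le).trans b1,
      (mul_le_mul_of_nonneg_left l hm.le).trans d1,
      mul_le_mul l r (by positivity) (by linarith)⟩, ?_⟩
    have := hF _ (φ.mem_Icc θ) _ (u.mem_Icc θ) (by
      rw [dist_comm, Real.dist_eq]; linarith [hu θ])
    exact this.le
  constructor
  · have hu : ∀ t ∈ Icc (0 : ℝ) 1, ∀ θ, |interp φ σ t θ - φ θ| ≤ η := fun t ht θ => by
      rw [interp_apply _ _ ht, show (1 - t) * φ θ + t * σ θ - φ θ = t * (σ θ - φ θ) by ring,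
        abs_mul, abs_of_nonneg ht.1]
      nlinarith [hclose θ, abs_nonneg (σ θ - φ θ), ht.2]
    -- Here `φ` is the starting point of the segment, whence `t₀ = 0`; for the reversed path it is
    -- the end point and `t₀ = 1`.
    refine (cheapPath_interp hc h' hσ h' h'' heq (t₀ := 0) (by simp) (fun θ => by ring) hb hχ₀
      (fun t ht θ => (key _ (hu t ht) θ).1) (α := α) (β := β) (fun t ht θ => ?_)
      fun θ => (hclose' θ).trans n4).mono hsum
    rw [add_sub_assoc]
    have := (key _ (hu t ht) θ).2
    exact (abs_add_le _ _).trans (by linarith [hclose θ])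
  · have hu : ∀ t ∈ Icc (0 : ℝ) 1, ∀ θ, |interp σ φ t θ - φ θ| ≤ η := fun t ht θ => by
      rw [interp_apply _ _ ht, show (1 - t) * σ θ + t * φ θ - φ θ = (1 - t) * (σ θ - φ θ) by ring,
        abs_mul, abs_of_nonneg (sub_nonneg.2 ht.2)]
      nlinarith [hclose θ, abs_nonneg (σ θ - φ θ), ht.1]
    refine (cheapPath_interp hc hσ h' h' h'' heq (t₀ := 1) (by simp) (fun θ => by ring) hb hχ₀
      (fun t ht θ => (key _ (hu t ht) θ).1) (α := α) (β := β) (fun t ht θ => ?_)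
      fun θ => by rw [abs_sub_comm]; exact (hclose' θ).trans n4).mono hsum
    rw [add_sub_assoc]
    have := (key _ (hu t ht) θ).2
    have h2 := hclose θ
    rw [abs_sub_comm] at h2
    exact (abs_add_le _ _).trans (by linarith)

theorem eventually_cheapPath_interp {c : Config → ℝ} (hpos : ∀ η, 0 < c η) (hc : IsCylinder c)
    {φ : Profile} (hφ : φ ∈ Stationary c) {ρ : ℝ → Profile} {l : Filter ℝ}
    (hl : TendstoC1 ρ φ l) {ε : ℝ} (hε : 0 < ε) :
    ∀ᶠ t in l, CheapPath c 1 (interp φ (ρ t)) ε ∧ CheapPath c 1 (interp (ρ t) φ) ε := by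
  obtain ⟨φ', h', η, hη, H⟩ := exists_cheapPath_interp hpos hc hφ hε
  obtain ⟨h1, -, h2, h3⟩ := hl
  filter_upwards [h1, Metric.tendstoUniformly_iff.1 h2 η hη,
    Metric.tendstoUniformly_iff.1 h3 η hη] with t t1 t2 t3
  obtain ⟨σ', hσ⟩ := exists_hasDx t1
  refine H (ρ t) σ' hσ (fun θ => ?_) fun θ => ?_
  · induction θ using QuotientAddGroup.induction_on with | _ x =>
    have := (t2 x).le
    rw [dist_comm] at this
    exact this
  · induction θ using QuotientAddGroup.induction_on with | _ x =>
    have := (t3 x).le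
    rw [dist_comm, hσ.deriv_lift, h'.deriv_lift] at this
    exact this

/-- Three pieces are joined: from `φ` to the orbit at time `s₀`, the orbit up to time `s₁`, then on
to `ψ`. Only the two interpolations cost anything. -/
theorem IsHeteroclinicOrbit.exists_cheapPath {c : Config → ℝ} (hpos : ∀ η, 0 < c η)
    (hc : IsCylinder c) {ρ : ℝ → Profile} {φ ψ : Profile} (h : IsHeteroclinicOrbit c ρ φ ψ)
    {ε : ℝ} (hε : 0 < ε) :
    ∃ T > 0, ∃ u, CheapPath c T u ε ∧ u 0 = φ ∧ u T = ψ := by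
  have hε2 : 0 < ε / 2 := by positivity
  -- The requirements `s₀ ≤ -1` and `1 ≤ s₁` only serve to make the middle piece of positive
  -- duration.
  obtain ⟨s₀, ⟨hs₀, -⟩, hs₀'⟩ := ((eventually_cheapPath_interp hpos hc h.source_mem
    h.tendsto_source hε2).and (eventually_le_atBot (-1))).exists
  obtain ⟨s₁, ⟨-, hs₁⟩, hs₁'⟩ := ((eventually_cheapPath_interp hpos hc h.target_mem
    h.tendsto_target hε2).and (eventually_ge_atTop 1)).exists
  have hsol : IsEntireSolution c ρ := h.solves
  have hL : 0 < s₁ - s₀ := by linarith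
  have e₁ : ρ (s₀ + (s₁ - s₀)) = interp (ρ s₁) ψ 0 := by rw [interp_zero, add_sub_cancel]
  have p₂ := ((hsol.shift s₀).cheapPath hpos hc hL).concat hc hL.le zero_le_one hs₁ e₁
  have e₂ : interp φ (ρ s₀) 1 =
      concat (s₁ - s₀) (fun t => ρ (s₀ + t)) (interp (ρ s₁) ψ) 0 := by
    rw [interp_one, concat_left hL.le, add_zero]
  have p := hs₀.concat hc zero_le_one (by positivity) p₂ e₂
  refine ⟨_, by positivity, _, p.mono (by linarith), ?_, ?_⟩
  · rw [concat_left zero_le_one, interp_zero]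
  · rw [add_comm 1, concat_right e₂ (by positivity), add_comm (s₁ - s₀),
      concat_right (u₁ := fun t => ρ (s₀ + t)) e₁ zero_le_one, interp_one]

theorem IsHeteroclinicOrbit.quasiPotential_eq_zero {c : Config → ℝ} (hpos : ∀ η, 0 < c η)
    (hc : IsCylinder c) {ρ : ℝ → Profile} {φ ψ : Profile} (h : IsHeteroclinicOrbit c ρ φ ψ)
    {M : Set SubProb} (hM : φ.toSubProb ∈ M) : quasiPotential c M ψ.toSubProb = 0 := by
  refine le_antisymm ?_ (quasiPotential_nonneg _ _ _)
  refine EReal.le_of_forall_lt_iff_le.1 fun ε hε => ?_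
  obtain ⟨T, hT, u, hu, h0, h1⟩ := h.exists_cheapPath hpos hc (EReal.coe_pos.1 hε)
  rw [← h1]
  exact hu.quasiPotential_le hc hT (by rwa [h0])

/-! ### Translations -/

theorem lift_add_const (f : Torus → ℝ) (y : ℝ) :
    lift (fun θ => f (θ + (y : Torus))) = fun x => lift f (x + y) := by
  funext x; simp [lift]

theorem lift_translate (γ : Profile) (y : ℝ) :
    lift (γ.translate (y : Torus)) = fun x => lift γ (x - y) := by
  funext x; simp [lift, Profile.translate]

theorem continuousOn_translate {T : ℝ} {f : ℝ → Torus → ℝ} (τ : Torus)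
    (hf : ContinuousOn (fun p : ℝ × Torus => f p.1 p.2) (Icc 0 T ×ˢ univ)) :
    ContinuousOn (fun p : ℝ × Torus => f p.1 (p.2 + τ)) (Icc 0 T ×ˢ univ) :=
  hf.comp (f := fun p : ℝ × Torus => (p.1, p.2 + τ)) (by fun_prop)
    fun _ hp => ⟨hp.1, mem_univ _⟩

/-- Translation of a test function in space. -/
def TestC12.translate {T : ℝ} (G : TestC12 T) (y : ℝ) : TestC12 T where
  fn := fun t θ => G.fn t (θ + (y : Torus))
  dt := fun t θ => G.dt t (θ + (y : Torus))
  dx := fun t θ => G.dx t (θ + (y : Torus))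
  dxx := fun t θ => G.dxx t (θ + (y : Torus))
  cont_fn := continuousOn_translate _ G.cont_fn
  cont_dt := continuousOn_translate _ G.cont_dt
  cont_dx := continuousOn_translate _ G.cont_dx
  cont_dxx := continuousOn_translate _ G.cont_dxx
  hasDeriv_dt := fun t ht θ => G.hasDeriv_dt t ht _
  hasDeriv_dx := fun t ht x => by
    rw [lift_add_const, lift_add_const]
    exact (G.hasDeriv_dx t ht (x + y)).comp_add_const x y
  hasDeriv_dxx := fun t ht x => by
    rw [lift_add_const, lift_add_const]
    exact (G.hasDeriv_dxx t ht (x + y)).comp_add_const x y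

theorem integral_translate (f : ℝ → ℝ) (γ : Profile) (g : Torus → ℝ) (τ : Torus) :
    ∫ θ, f (γ.translate τ θ) * g θ = ∫ θ, f (γ θ) * g (θ + τ) := by
  rw [← integral_sub_right_eq_self (fun θ => f (γ θ) * g (θ + τ)) τ]
  simp [Profile.translate]

theorem IsWeakSolution.translate {c : Config → ℝ} {T : ℝ} {γ : Profile} {ρ : ℝ → Profile}
    (h : IsWeakSolution c T γ ρ) (y : ℝ) :
    IsWeakSolution c T (γ.translate (y : Torus)) (fun t => (ρ t).translate (y : Torus)) := by
  refine ⟨h.1.comp (measurable_fst.prodMk (measurable_snd.sub_const (y : Torus))), fun G => ?_⟩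
  have key := h.2 (G.translate y)
  have e1 := fun (γ : Profile) (g : Torus → ℝ) => integral_translate id γ g (y : Torus)
  simp only [id] at e1
  have e2 := fun (γ : Profile) (g : Torus → ℝ) => integral_translate (reaction c) γ g (y : Torus)
  simp only [e1, e2]
  exact key

theorem Stationary.translate {c : Config → ℝ} {φ : Profile} (h : φ ∈ Stationary c) (y : ℝ) :
    φ.translate (y : Torus) ∈ Stationary c := by
  refine ⟨?_, fun x => ?_⟩
  · rw [lift_translate]
    exact h.1.comp (contDiff_id.sub contDiff_const)
  · rw [lift_translate, iteratedDeriv_comp_sub_const]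
    exact h.2 (x - y)

theorem TendstoC1.translate {ρ : ℝ → Profile} {φ : Profile} {l : Filter ℝ}
    (h : TendstoC1 ρ φ l) (y : ℝ) :
    TendstoC1 (fun t => (ρ t).translate (y : Torus)) (φ.translate (y : Torus)) l := by
  obtain ⟨h1, h2, h3, h4⟩ := h
  unfold TendstoC1
  have e : ∀ f : ℝ → ℝ, (deriv fun x => f (x - y)) = fun x => deriv f (x - y) :=
    fun f => funext fun x => deriv_comp_sub_const f y x
  simp only [lift_translate, e]
  exact ⟨h1.mono fun t ht => ht.comp (contDiff_id.sub contDiff_const),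
    h2.comp (contDiff_id.sub contDiff_const), h3.comp fun x => x - y, h4.comp fun x => x - y⟩

theorem IsHeteroclinicOrbit.translate {c : Config → ℝ} {ρ : ℝ → Profile} {φ ψ : Profile}
    (h : IsHeteroclinicOrbit c ρ φ ψ) (y : ℝ) :
    IsHeteroclinicOrbit c (fun t => (ρ t).translate (y : Torus)) (φ.translate (y : Torus))
      (ψ.translate (y : Torus)) where
  source_mem := Stationary.translate h.source_mem y
  target_mem := Stationary.translate h.target_mem y
  ne := fun he => h.ne <| Profile.ext fun θ => by
    have := congrArg (fun γ : Profile => γ (θ + (y : Torus))) he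
    simpa [Profile.translate] using this
  solves := fun s T hT => (h.solves s T hT).translate y
  tendsto_source := h.tendsto_source.translate y
  tendsto_target := h.tendsto_target.translate y

/-- Equality of measures means equality of densities almost everywhere, which survives translation
because translations preserve Lebesgue measure. -/
theorem translate_toSubProb {γ γ' : Profile} {ω : Torus}
    (h : γ.toSubProb = (γ'.translate ω).toSubProb) (τ : Torus) :
    (γ.translate τ).toSubProb = (γ'.translate (ω + τ)).toSubProb := by
  rw [Profile.toSubProb_eq_iff] at h ⊢
  have := (measurePreserving_sub_right (volume : Measure Torus) τ).quasiMeasurePreserving.ae_eq_comp h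
  refine this.trans (ae_of_all _ fun θ => ?_)
  simp only [Function.comp, Profile.translate, sub_sub, add_comm]

theorem translate_mem_translates {γ γ' : Profile} (h : γ.toSubProb ∈ translates γ') (τ : Torus) :
    (γ.translate τ).toSubProb ∈ translates γ' := by
  obtain ⟨ω, hω⟩ := h
  exact ⟨ω + τ, translate_toSubProb hω τ⟩

/-- Any two elements of a set of translates differ by a translation. -/
theorem exists_translate_eq {ψ γ : Profile} (h : ψ.toSubProb ∈ translates γ) {ϱ : SubProb}
    (hϱ : ϱ ∈ translates γ) : ∃ y : ℝ, (ψ.translate (y : Torus)).toSubProb = ϱ := by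
  obtain ⟨ω, hω⟩ := h
  obtain ⟨ω', rfl⟩ := hϱ
  obtain ⟨y, hy⟩ := QuotientAddGroup.mk_surjective (ω' - ω)
  refine ⟨y, ?_⟩
  have := translate_toSubProb hω (y : Torus)
  rw [this]
  congr 2
  rw [show (y : Torus) = ω' - ω from hy]
  abel

theorem toSubProb_mem_translates (γ : Profile) : γ.toSubProb ∈ translates γ :=
  ⟨0, congrArg _ (Profile.ext fun θ => by simp [Profile.translate])⟩

end ReactionDiffusion

/-! ### Vanishing of the quasi-potential on the whole target class -/

open ReactionDiffusion
theorem lemma6p1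
    -- a strictly positive cylinder function: the spin-flip rates
    (c : Config → ℝ) (hpos : ∀ η, 0 < c η) (hcyl : IsCylinder c)
    -- finitely many stationary solutions modulo translations
    (l : ℕ) (ρbar : Fin l → Profile) (hC2 : ∀ i, ContDiff ℝ 2 (lift (ρbar i)))
    (hsol : StationaryMeasures c = ⋃ i, translates (ρbar i))
    -- a heteroclinic orbit from an element of `𝓜_i` to an element of `𝓜_j`
    (i j : Fin l) (φ ψ : Profile)
    (hφ : φ.toSubProb ∈ translates (ρbar i)) (hψ : ψ.toSubProb ∈ translates (ρbar j))
    (horbit : ∃ ρ : ℝ → Profile, IsHeteroclinicOrbit c ρ φ ψ) :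
    -- `V_i` is constant on `𝓜_j`, and its value `v_{ij}` there vanishes
    (∀ ϱ ∈ translates (ρbar j),
      quasiPotential c (translates (ρbar i)) ϱ = transitionCost c ρbar i j) ∧
    transitionCost c ρbar i j = 0 := by
  obtain ⟨ρ, hρ⟩ := horbit
  have key : ∀ ϱ ∈ translates (ρbar j), quasiPotential c (translates (ρbar i)) ϱ = 0 := by
    intro ϱ hϱ
    -- The prescribed `ϱ` is a translate of `ψ`. Translating the orbit by the same amount makes it
    -- end there, and its new source still belongs to the class of `ρbar i`.
    obtain ⟨y, rfl⟩ := exists_translate_eq hψ hϱ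
    exact (hρ.translate y).quasiPotential_eq_zero hpos hcyl (translate_mem_translates hφ y)
  have h0 : transitionCost c ρbar i j = 0 := key _ (toSubProb_mem_translates _)
  exact ⟨fun ϱ hϱ => (key ϱ hϱ).trans h0.symm, h0⟩
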